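/- **Theorem (deterministic sampling).** Let $G$ be a finite directed graph on $n=|V(G)|$ vertices, let $V^{\infty}\subseteq V(G)$ be a set of distinguished (undeletable) vertices, let $T\subseteq V^{\infty}$ be a set of terminals, and let $p\ge 0$ be an integer. *Definitions.* For disjoint non-empty $X,Y\subseteq V(G)$, an $X$–$Y$ separator is a set $S\subseteq V(G)\setminus(X\cup Y\cup V^{\infty})$ such that $G\setminus S$ has no directed path from $X$ to $Y$; it is minimal if no proper subset of it is an $X$–$Y$ separator. Let $R^+_{G\setminus S}(X)$ be the set of vertices reachable from $X$ in $G\setminus S$. A minimal $X$–$Y$ separator $S$ is important if there is no $X$–$Y$ separator $S'$ with $|S'|\le|S|$ and $R^+_{G\setminus S}(X)\subsetneq R^+_{G\setminus S'}(X)$. A $v$–$T$ separator is a $\{v\}$–$T$ separator. A set $S\subseteq V(G)\setminus V^{\infty}$ is thin if there is no $v\in S$ such that $S\setminus\{v\}$ is a $v$–$T$ separator. *Statement.* There are a deterministic algorithm and an absolute constant $c$ such that, on every input $(G,V^{\infty},T,p)$, the algorithm halts after at most $2^{2^{c(p+1)}}(n+1)^{c}$ steps (that is, in time $O^*(2^{2^{O(p)}})$)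 and outputs subsets $Z_1,\dots,Z_t$ of $V(G)\setminus T$ with $$t\le 2^{2^{c(p+1)}}\,(1+\lfloor\log_2 n\rfloor)$$ (read $\lfloor\log_2 0\rfloor$ as $0$), for which the following holds. Let $S\subseteq V(G)\setminus V^{\infty}$ be a thin set with $|S|\le p$, and let $Y\subseteq V(G)$ be a set such that for every $v\in Y$ there is an important $v$–$T$ separator $S'\subseteq S$. Then for every such pair $(S,Y)$ there is at least one $1\le i\le t$ with 1. $S\cap Z_i=\emptyset$, and 2. $Y\subseteq Z_i$. -/

import Mathlib

namespace DetSampling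

/-! ## Separators in directed graphs

`G` is a directed graph, `W` is its set of distinguished (undeletable) vertices, `T` is its set of
terminals. -/

section Graph

variable {V : Type*} [DecidableEq V]

/-- There is a (possibly trivial) directed path from `u` to `v` in `G \ S`. -/
def Reaches (G : Digraph V) (S : Finset V) (u v : V) : Prop :=
  u ∉ S ∧ Relation.ReflTransGen (fun a b => G.Adj a b ∧ b ∉ S) u v

/-- The set of vertices reachable from `X` in `G \ S`. -/
def reachSet (G : Digraph V) (S X : Finset V) : Set V :=
  {v | ∃ x ∈ X, Reaches G S x v}

/-- `S` is an `X - Y` separator of `G`, where `W` is the set of distinguished vertices. -/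
structure IsSeparator (G : Digraph V) (W X Y S : Finset V) : Prop where
  nonempty_left : X.Nonempty
  nonempty_right : Y.Nonempty
  disjoint : Disjoint X Y
  disjoint_left : Disjoint S X
  disjoint_right : Disjoint S Y
  disjoint_distinguished : Disjoint S W
  no_path : ∀ x ∈ X, ∀ y ∈ Y, ¬ Reaches G S x y

/-- `S` is an inclusion-wise minimal `X - Y` separator. -/
def IsMinimalSeparator (G : Digraph V) (W X Y S : Finset V) : Prop :=
  IsSeparator G W X Y S ∧ ∀ S', S' ⊂ S → ¬ IsSeparator G W X Y S'

/-- `S` is an important `X - Y` separator. -/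
def IsImportantSeparator (G : Digraph V) (W X Y S : Finset V) : Prop :=
  IsMinimalSeparator G W X Y S ∧
    ¬ ∃ S', IsSeparator G W X Y S' ∧ S'.card ≤ S.card ∧ reachSet G S X ⊂ reachSet G S' X

/-- The reverse shadow of `S` with respect to `T`. -/
def reverseShadow (G : Digraph V) (W T S : Finset V) : Set V :=
  {v | IsSeparator G W {v} T S}

/-- No vertex `v` of `S` lies in the reverse shadow of `S \ {v}`. -/
def IsThin (G : Digraph V) (W T S : Finset V) : Prop :=
  ∀ v ∈ S, v ∉ reverseShadow G W T (S.erase v)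

end Graph

/-! ## The machine model

A deterministic pointer machine: `while` programs over binary trees with natural numbers at the
leaves. A counted step performs a bounded number of pointer operations (trees are shared, never
copied) or adds or subtracts one or compares two leaves. As a number grows by at most one per step,
the model is polynomially equivalent to Turing machines and to random access machines. -/

/-- The data: binary trees with natural numbers at the leaves. -/
inductive Val : Type
  | atom (n : ℕ) : Val
  | pair (a b : Val) : Val

namespace Val

def succ : Val → Val
  | atom n => atom (n + 1)
  | pair _ _ => atom 0

def pred : Val → Val
  | atom n => atom (n - 1)
  | pair _ _ => atom 0

/-- Comparison of the two leaves of a pair: `1` for "less than" and `0` otherwise. -/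
def less : Val → Val
  | pair (atom a) (atom b) => if a < b then atom 1 else atom 0
  | _ => atom 0

def fst : Val → Val
  | pair a _ => a
  | atom _ => atom 0

def snd : Val → Val
  | pair _ b => b
  | atom _ => atom 0

/-- A list as a tree: `atom 0` is the empty list, `pair` puts a head before a tail. -/
def ofList : List Val → Val
  | [] => atom 0
  | a :: l => pair a (ofList l)

/-- A truth value as a leaf: `1` for true and `0` for false. -/
def ofBool (b : Bool) : Val := atom (if b then 1 else 0)

end Val

/-- Programs; each one transforms a tree into a tree. -/
inductive Prog : Type
  | id : Prog
  | zero : Prog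
  | succ : Prog
  | pred : Prog
  | less : Prog
  | fst : Prog
  | snd : Prog
  /-- `pair f g` sends `x` to the pair of `f x` and `g x`. -/
  | pair (f g : Prog) : Prog
  /-- `seq f g` runs `f` first and then `g` on its result. -/
  | seq (f g : Prog) : Prog
  /-- `cond c f g` runs `f` if the value of `c` is different from `atom 0`, and `g` otherwise. -/
  | cond (c f g : Prog) : Prog
  /-- `loop c f` replaces `x` by `f x` as long as the value of `c` at `x` differs from `atom 0`. -/
  | loop (c f : Prog) : Prog

/-- `Runs P x y k`: on input `x` the program `P` halts with output `y` after exactly `k` steps. -/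
inductive Runs : Prog → Val → Val → ℕ → Prop
  | id (x : Val) : Runs Prog.id x x 1
  | zero (x : Val) : Runs Prog.zero x (Val.atom 0) 1
  | succ (x : Val) : Runs Prog.succ x x.succ 1
  | pred (x : Val) : Runs Prog.pred x x.pred 1
  | less (x : Val) : Runs Prog.less x x.less 1
  | fst (x : Val) : Runs Prog.fst x x.fst 1
  | snd (x : Val) : Runs Prog.snd x x.snd 1
  | pair {f g : Prog} {x y z : Val} {k l : ℕ} :
      Runs f x y k → Runs g x z l → Runs (Prog.pair f g) x (Val.pair y z) (k + l + 1)
  | seq {f g : Prog} {x y z : Val} {k l : ℕ} :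
      Runs f x y k → Runs g y z l → Runs (Prog.seq f g) x z (k + l + 1)
  | cond_true {c f g : Prog} {x b y : Val} {k l : ℕ} :
      Runs c x b k → b ≠ Val.atom 0 → Runs f x y l → Runs (Prog.cond c f g) x y (k + l + 1)
  | cond_false {c f g : Prog} {x y : Val} {k l : ℕ} :
      Runs c x (Val.atom 0) k → Runs g x y l → Runs (Prog.cond c f g) x y (k + l + 1)
  | loop_stop {c f : Prog} {x : Val} {k : ℕ} :
      Runs c x (Val.atom 0) k → Runs (Prog.loop c f) x x (k + 1)
  | loop_step {c f : Prog} {x b y z : Val} {k l m : ℕ} :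
      Runs c x b k → b ≠ Val.atom 0 → Runs f x y l → Runs (Prog.loop c f) y z m →
        Runs (Prog.loop c f) x z (k + l + m + 1)

/-- The machine is deterministic: output and running time are determined by program and input. -/
theorem Runs.deterministic {P : Prog} {x y : Val} {k : ℕ} (h : Runs P x y k) :
    ∀ {y' : Val} {k' : ℕ}, Runs P x y' k' → y = y' ∧ k = k' := by
  induction h with
  | pair _ _ ih₁ ih₂ =>
    intro _ _ h'
    cases h' with
    | pair h₁ h₂ =>
      obtain ⟨rfl, rfl⟩ := ih₁ h₁
      obtain ⟨rfl, rfl⟩ := ih₂ h₂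
      exact ⟨rfl, rfl⟩
  | seq _ _ ih₁ ih₂ =>
    intro _ _ h'
    cases h' with
    | seq h₁ h₂ =>
      obtain ⟨rfl, rfl⟩ := ih₁ h₁
      obtain ⟨rfl, rfl⟩ := ih₂ h₂
      exact ⟨rfl, rfl⟩
  | cond_true _ hb _ ih₁ ih₂ =>
    intro _ _ h'
    cases h' with
    | cond_true h₁ _ h₂ =>
      obtain ⟨rfl, rfl⟩ := ih₁ h₁
      obtain ⟨rfl, rfl⟩ := ih₂ h₂
      exact ⟨rfl, rfl⟩
    | cond_false h₁ _ => exact absurd (ih₁ h₁).1 hb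
  | cond_false _ _ ih₁ ih₂ =>
    intro _ _ h'
    cases h' with
    | cond_true h₁ hb _ => exact absurd (ih₁ h₁).1.symm hb
    | cond_false h₁ h₂ =>
      obtain ⟨_, rfl⟩ := ih₁ h₁
      obtain ⟨rfl, rfl⟩ := ih₂ h₂
      exact ⟨rfl, rfl⟩
  | loop_stop _ ih =>
    intro _ _ h'
    cases h' with
    | loop_stop h₁ =>
      obtain ⟨_, rfl⟩ := ih h₁
      exact ⟨rfl, rfl⟩
    | loop_step h₁ hb _ _ => exact absurd (ih h₁).1.symm hb
  | loop_step _ hb _ _ ih₁ ih₂ ih₃ =>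
    intro _ _ h'
    cases h' with
    | loop_stop h₁ => exact absurd (ih₁ h₁).1 hb
    | loop_step h₁ _ h₂ h₃ =>
      obtain ⟨rfl, rfl⟩ := ih₁ h₁
      obtain ⟨rfl, rfl⟩ := ih₂ h₂
      obtain ⟨rfl, rfl⟩ := ih₃ h₃
      exact ⟨rfl, rfl⟩
  | _ =>
    intro _ _ h'
    cases h'
    exact ⟨rfl, rfl⟩

/-! ## Input and output format -/

/-- A vertex set as its characteristic vector. -/
def encodeSet {n : ℕ} (A : Finset (Fin n)) : Val :=
  Val.ofList ((List.finRange n).map fun i => Val.ofBool (decide (i ∈ A)))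

/-- A directed graph as its adjacency matrix, row by row. -/
def encodeGraph {n : ℕ} (G : Digraph (Fin n)) [DecidableRel G.Adj] : Val :=
  Val.ofList ((List.finRange n).map fun i =>
    Val.ofList ((List.finRange n).map fun j => Val.ofBool (decide (G.Adj i j))))

/-- The input: number of vertices, graph, distinguished vertices, terminals, and parameter. -/
def encodeInput {n : ℕ} (G : Digraph (Fin n)) [DecidableRel G.Adj] (W T : Finset (Fin n))
    (p : ℕ) : Val :=
  Val.ofList [Val.atom n, encodeGraph G, encodeSet W, encodeSet T, Val.atom p]

/-- The output: a list of vertex sets. -/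
def encodeFamily {n : ℕ} (Z : List (Finset (Fin n))) : Val :=
  Val.ofList (Z.map encodeSet)

end DetSampling

-- For every vertex v, list 2^(2p+1) candidate sets among which every important v–T separator of
-- size at most p occurs. Given some set of selected vertices, let Z consist of the vertices v that
-- have a candidate of size at most p which is a v–T separator and contains only selected vertices.
-- Let K be the union of the candidates of size at most p of the vertices of S, without S itself. If
-- all of S and nothing of K is selected, then Z is as required. Each v in Y lies in Z, because its
-- important separator inside S is one of its candidates. If some v in S were in Z, the candidate
-- responsible would avoid K, hence lie in S \ {v}, and S \ {v} would be a v–T separator, against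
-- thinness. This is `exists_sampleSet`. Since |S|·|K| is at most p³·2^(2p+1), two ingredients
-- remain.
--
-- Candidates (`exists_branchState_eq`). A branching state is a pair of a set X to be deleted and a
-- set A to be kept on the source side. The minimum cut furthest from v is computed by augmenting
-- paths in the split network, and a vertex x on it is put either into X or into A. By
-- submodularity, for an important separator S compatible with the state, x is in S or reachable
-- from v in G \ S (`mem_of_isCrossing`), so one of the two choices stays compatible. Each such
-- choice raises 2|X| plus the minimum cut value, which never exceeds 2p. Hence 2p+1 binary
-- decisions, the digits of a number b, suffice.
--
-- Selections (`exists_separating_color`). Let r bound the number of pairs in S × K. Colour the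
-- vertices with 4r colours repeatedly, giving each pair of vertices the weight 2 to the number of
-- earlier collisions. A greedy colouring, the derandomised form of a random one, lets at most a
-- 1/(4r) fraction of the weight collide, so the total weight grows slowly and after 2rs rounds with
-- n² < 2^s every pair has collided fewer than 2s times. By counting, some round has no collision
-- between S and K. Selecting the vertices whose colours occur on S then works, and all 2^(4r) sets
-- of colours are tried.
--
-- Complexity. `PolyComp` expresses that one program computes a family of values in time polynomial
-- in a magnitude, with polynomially bounded leaves. It is closed under bounded iteration, tables
-- and search, and every construction above is built from these. With the magnitude
-- 2^(2^(5(p+1)))·(n+2), both 2^(4r) and the candidate count are polynomial.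

namespace DetSampling

/-! ## Uniform polynomial-time computability -/

/-- The largest leaf of a tree. -/
def Val.top : Val → ℕ
  | atom n => n
  | pair a b => max a.top b.top

@[simp] theorem Val.top_atom (n : ℕ) : (Val.atom n).top = n := rfl

@[simp] theorem Val.top_pair (a b : Val) : (Val.pair a b).top = max a.top b.top := rfl

/-- A truth value as a leaf. -/
noncomputable def Val.ofProp (P : Prop) : Val :=
  open Classical in Val.atom (if P then 1 else 0)

/-- `f` is bounded by a polynomial in `m`. -/
def PolyBdd {ι : Type} (m f : ι → ℕ) : Prop :=
  ∃ c, ∀ i, f i ≤ (m i + 2) ^ c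

namespace PolyBdd

variable {ι : Type} {m f g : ι → ℕ}

theorem mono (hf : PolyBdd m f) (h : ∀ i, g i ≤ f i) : PolyBdd m g := by
  obtain ⟨c, hc⟩ := hf
  exact ⟨c, fun i => (h i).trans (hc i)⟩

theorem mul (hf : PolyBdd m f) (hg : PolyBdd m g) : PolyBdd m (fun i => f i * g i) := by
  obtain ⟨c, hc⟩ := hf
  obtain ⟨d, hd⟩ := hg
  exact ⟨c + d, fun i => by rw [pow_add]; exact Nat.mul_le_mul (hc i) (hd i)⟩

theorem self : PolyBdd m m := ⟨1, fun i => by simp⟩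

/-- The base `m i + 2` is at least 2, so a constant n is absorbed by the exponent n. -/
theorem const (n : ℕ) : PolyBdd m (fun _ => n) :=
  ⟨n, fun i => n.lt_two_pow_self.le.trans (Nat.pow_le_pow_left (by omega) n)⟩

theorem add (hf : PolyBdd m f) (hg : PolyBdd m g) : PolyBdd m (fun i => f i + g i) := by
  obtain ⟨c, hc⟩ := hf
  obtain ⟨d, hd⟩ := hg
  refine ⟨c + d + 1, fun i => ?_⟩
  have h1 : (m i + 2) ^ c ≤ (m i + 2) ^ (c + d) := Nat.pow_le_pow_right (by omega) (by omega)
  have h2 : (m i + 2) ^ d ≤ (m i + 2) ^ (c + d) := Nat.pow_le_pow_right (by omega) (by omega)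
  have h3 : 2 * (m i + 2) ^ (c + d) ≤ (m i + 2) ^ (c + d + 1) := by
    rw [pow_succ, mul_comm]; exact Nat.mul_le_mul_left _ (by omega)
  have := hc i
  have := hd i
  dsimp only
  omega

theorem max (hf : PolyBdd m f) (hg : PolyBdd m g) : PolyBdd m (fun i => max (f i) (g i)) :=
  (hf.add hg).mono fun i => by omega

theorem reindex {κ : Type} (e : κ → ι) (hf : PolyBdd m f) :
    PolyBdd (fun q => m (e q)) (fun q => f (e q)) := by
  obtain ⟨c, hc⟩ := hf
  exact ⟨c, fun q => hc (e q)⟩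

end PolyBdd

/-- One program computes all the values `y i` from the values `x i`, in time polynomial in `m i`,
and the leaves of `x i` and `y i` are bounded by a polynomial in `m i`. -/
def PolyComp {ι : Type} (m : ι → ℕ) (x y : ι → Val) : Prop :=
  PolyBdd m (fun i => (x i).top) ∧ PolyBdd m (fun i => (y i).top) ∧
    ∃ (P : Prog) (t : ι → ℕ), PolyBdd m t ∧ ∀ i, ∃ k ≤ t i, Runs P (x i) (y i) k

/-- Running time of a loop that counts down. -/
theorem Runs.countdown {B : Prog} {z : ℕ → Val} {r t : ℕ}
    (hB : ∀ j < r, ∃ k ≤ t, Runs B (.pair (z j) (.atom (r - j))) (.pair (z (j + 1)) (.atom (r - (j + 1)))) k) :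
    ∀ n ≤ r, ∃ k ≤ (t + 3) * n + 2,
      Runs (.loop .snd B) (.pair (z (r - n)) (.atom n)) (.pair (z r) (.atom 0)) k := by
  intro n
  induction n with
  | zero =>
    intro _
    exact ⟨2, by omega, Runs.loop_stop (.snd (.pair (z r) (.atom 0)))⟩
  | succ n ih =>
    intro hn
    obtain ⟨k, hk, h⟩ := ih (by omega)
    obtain ⟨l, hl, h'⟩ := hB (r - (n + 1)) (by omega)
    rw [show r - (r - (n + 1)) = n + 1 by omega, show r - (n + 1) + 1 = r - n by omega,
      show r - (r - n) = n by omega] at h'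
    refine ⟨_, ?_, .loop_step (.snd _) (by simp [Val.snd]) h' h⟩
    rw [mul_add]
    omega

namespace PolyComp

variable {ι : Type} {m : ι → ℕ} {x y z : ι → Val}

theorem bdd (h : PolyComp m x y) : PolyBdd m (fun i => (y i).top) := h.2.1

theorem env_bdd (h : PolyComp m x y) : PolyBdd m (fun i => (x i).top) := h.1

theorem bdd_atom {a : ι → ℕ} (h : PolyComp m x (fun i => .atom (a i))) : PolyBdd m a := h.2.1

theorem comp (h : PolyComp m x y) (h' : PolyComp m y z) : PolyComp m x z := by
  obtain ⟨hx, -, P, t, ht, hP⟩ := h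
  obtain ⟨-, hz, Q, u, hu, hQ⟩ := h'
  refine ⟨hx, hz, .seq P Q, fun i => t i + u i + 1, (ht.add hu).add (.const 1), fun i => ?_⟩
  obtain ⟨k, hk, h1⟩ := hP i
  obtain ⟨l, hl, h2⟩ := hQ i
  exact ⟨_, by dsimp only; omega, .seq h1 h2⟩

theorem reindex {κ : Type} (e : κ → ι) (h : PolyComp m x y) :
    PolyComp (fun q => m (e q)) (fun q => x (e q)) (fun q => y (e q)) := by
  obtain ⟨hx, hy, P, t, ht, hP⟩ := h
  exact ⟨hx.reindex e, hy.reindex e, P, _, ht.reindex e, fun q => hP (e q)⟩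

theorem congr (h : PolyComp m x y) (e : ∀ i, z i = y i) : PolyComp m x z := by
  rwa [show z = y from funext e]

theorem env (h : PolyBdd m (fun i => (x i).top)) : PolyComp m x x :=
  ⟨h, h, .id, _, .const 1, fun _ => ⟨1, le_rfl, .id _⟩⟩

theorem pair (h : PolyComp m x y) (h' : PolyComp m x z) :
    PolyComp m x (fun i => .pair (y i) (z i)) := by
  obtain ⟨hx, hy, P, t, ht, hP⟩ := h
  obtain ⟨-, hz, Q, u, hu, hQ⟩ := h'
  refine ⟨hx, hy.max hz, .pair P Q, fun i => t i + u i + 1, (ht.add hu).add (.const 1), fun i => ?_⟩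
  obtain ⟨k, hk, h1⟩ := hP i
  obtain ⟨l, hl, h2⟩ := hQ i
  exact ⟨_, by dsimp only; omega, .pair h1 h2⟩

theorem of_prog {P : Prog} {c : ℕ} (h : PolyComp m x y) (hz : PolyBdd m (fun i => (z i).top))
    (hP : ∀ i, Runs P (y i) (z i) c) : PolyComp m x z :=
  h.comp ⟨h.bdd, hz, P, _, .const c, fun i => ⟨c, le_rfl, hP i⟩⟩

theorem fst (h : PolyComp m x (fun i => .pair (y i) (z i))) : PolyComp m x y :=
  h.of_prog (h.bdd.mono fun i => by simp) fun _ => .fst _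

theorem snd (h : PolyComp m x (fun i => .pair (y i) (z i))) : PolyComp m x z :=
  h.of_prog (h.bdd.mono fun i => by simp) fun _ => .snd _

theorem zero (h : PolyBdd m (fun i => (x i).top)) : PolyComp m x (fun _ => .atom 0) :=
  (env h).of_prog (.const 0) fun _ => .zero _

theorem succ {a : ι → ℕ} (h : PolyComp m x (fun i => .atom (a i))) :
    PolyComp m x (fun i => .atom (a i + 1)) :=
  h.of_prog (h.bdd.add (.const 1)) fun _ => .succ _

theorem pred {a : ι → ℕ} (h : PolyComp m x (fun i => .atom (a i))) :
    PolyComp m x (fun i => .atom (a i - 1)) :=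
  h.of_prog (h.bdd.mono fun i => by simp) fun _ => .pred _

theorem const (h : PolyBdd m (fun i => (x i).top)) (n : ℕ) :
    PolyComp m x (fun _ => .atom n) := by
  induction n with
  | zero => exact zero h
  | succ n ih => exact succ ih

theorem bdd_ofProp {p : ι → Prop} : PolyBdd m (fun i => (Val.ofProp (p i)).top) :=
  (PolyBdd.const 1).mono fun i => by unfold Val.ofProp; split <;> simp

theorem lt {a b : ι → ℕ} (ha : PolyComp m x (fun i => .atom (a i)))
    (hb : PolyComp m x (fun i => .atom (b i))) :
    PolyComp m x (fun i => .ofProp (a i < b i)) := by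
  refine (ha.pair hb).of_prog (P := .less) (c := 1) bdd_ofProp fun i => ?_
  convert Runs.less _ using 1
  dsimp only [Val.less, Val.ofProp]
  split <;> rfl

open Classical in
theorem ite {p : ι → Prop} (hp : PolyComp m x (fun i => .ofProp (p i))) (hy : PolyComp m x y)
    (hz : PolyComp m x z) : PolyComp m x (fun i => if p i then y i else z i) := by
  refine ⟨hp.env_bdd, (hy.bdd.add hz.bdd).mono fun i => by dsimp only; split <;> simp, ?_⟩
  obtain ⟨-, -, R, v, hv, hR⟩ := hp
  obtain ⟨-, -, P, t, ht, hP⟩ := hy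
  obtain ⟨-, -, Q, u, hu, hQ⟩ := hz
  refine ⟨.cond R P Q, fun i => v i + (t i + u i) + 1, (hv.add (ht.add hu)).add (.const 1),
    fun i => ?_⟩
  obtain ⟨k, hk, h1⟩ := hP i
  obtain ⟨l, hl, h2⟩ := hQ i
  obtain ⟨j, hj, h3⟩ := hR i
  by_cases h : p i
  · simp only [h, if_true]
    exact ⟨_, by omega, .cond_true h3 (by simp [Val.ofProp, h]) h1⟩
  · simp only [h, if_false]
    simp only [Val.ofProp, h, if_false] at h3
    exact ⟨_, by omega, .cond_false h3 h2⟩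

open Classical in
theorem ite_atom {p : ι → Prop} {a b : ι → ℕ} (hp : PolyComp m x (fun i => .ofProp (p i)))
    (ha : PolyComp m x (fun i => .atom (a i))) (hb : PolyComp m x (fun i => .atom (b i))) :
    PolyComp m x (fun i => .atom (if p i then a i else b i)) :=
  (ite hp ha hb).congr fun i => by split <;> rfl

/-- The hypothesis on the body ranges over all instances and all rounds at once, so a single program
and a single polynomial serve every round. Its uniform bound on the leaves of all intermediate
states is essential: composing a polynomial bound with itself k times would not give a polynomial.
-/
theorem recN {s : ∀ _ : ι, ℕ → Val} {k : ι → ℕ}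
    (hk : PolyComp m x (fun i => .atom (k i))) (h0 : PolyComp m x (fun i => s i 0))
    (hs : PolyComp (ι := Σ i, Fin (k i)) (fun q => m q.1)
      (fun q => .pair (x q.1) (.pair (.atom q.2) (s q.1 q.2))) (fun q => s q.1 (q.2 + 1))) :
    PolyComp m x (fun i => s i (k i)) := by
  obtain ⟨hx, hk', K, tk, htk, hK⟩ := hk
  obtain ⟨-, h0', P0, t0, ht0, hP0⟩ := h0
  obtain ⟨-, ⟨d, hd⟩, B, tB, ⟨e, he⟩, hB⟩ := hs
  refine ⟨hx, ?_, ?_⟩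
  · refine (h0'.add (⟨d, fun i => le_rfl⟩ : PolyBdd m (fun i => (m i + 2) ^ d))).mono fun i => ?_
    dsimp only
    rcases Nat.eq_zero_or_pos (k i) with h | h
    · rw [h]; omega
    · have := hd ⟨i, ⟨k i - 1, by omega⟩⟩
      simp only [Nat.sub_add_cancel h] at this
      omega
  -- The machine state is ((environment, (index, state)), remaining rounds). The index counts up for
  -- the body, the last component counts down for the loop test.
  · refine ⟨.seq (.seq (.pair (.pair .id (.pair .zero P0)) K)
      (.loop .snd (.pair (.pair (.seq .fst .fst) (.pair (.seq .fst (.seq .snd (.seq .fst .succ)))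
        (.seq .fst B))) (.seq .snd .pred)))) (.seq .fst (.seq .snd .snd)),
      fun i => (((m i + 2) ^ e + 30) * k i + (t0 i + tk i + 30)),
      (((show PolyBdd m (fun i => (m i + 2) ^ e) from ⟨e, fun i => le_rfl⟩).add (.const 30)).mul
        hk').add ((ht0.add htk).add (.const 30)), fun i => ?_⟩
    obtain ⟨a, ha, h1⟩ := hK i
    obtain ⟨b, hb, h2⟩ := hP0 i
    obtain ⟨l, hl, h3⟩ := Runs.countdown
      (B := .pair (.pair (.seq .fst .fst) (.pair (.seq .fst (.seq .snd (.seq .fst .succ)))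
        (.seq .fst B))) (.seq .snd .pred))
      (z := fun j => .pair (x i) (.pair (.atom j) (s i j))) (r := k i) (t := (m i + 2) ^ e + 20)
      (fun j hj => by
        obtain ⟨l, hl, h⟩ := hB ⟨i, ⟨j, hj⟩⟩
        have := he ⟨i, ⟨j, hj⟩⟩
        dsimp only at this
        refine ⟨_, ?_, .pair (.pair (.seq (.fst _) (.fst _)) (.pair (.seq (.fst _) (.seq (.snd _)
          (.seq (.fst _) (.succ _)))) (.seq (.fst _) h))) (.seq (.snd _) (.pred _))⟩
        omega) (k i) le_rfl
    rw [Nat.sub_self] at h3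
    refine ⟨_, ?_, .seq (.seq (.pair (.pair (.id _) (.pair (.zero _) h2)) h1) h3)
      (.seq (.fst _) (.seq (.snd _) (.snd _)))⟩
    have : ((m i + 2) ^ e + 20 + 3) * k i ≤ ((m i + 2) ^ e + 30) * k i :=
      Nat.mul_le_mul_right _ (by omega)
    dsimp only
    omega

variable {ι : Type} {m : ι → ℕ} {x y z : ι → Val}

/-- A value that is computed from `x` is computed from `x` together with further data. -/
theorem lift {κ : Type} {e : κ → ι} {w : κ → Val} (h : PolyComp m x y)
    (hw : PolyBdd (fun q => m (e q)) (fun q => (w q).top)) :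
    PolyComp (fun q => m (e q)) (fun q => .pair (x (e q)) (w q)) (fun q => y (e q)) :=
  (env ((h.env_bdd.reindex e).max hw)).fst.comp (h.reindex e)

/-- A value that is computed from `x` is computed from `x` and an index. -/
theorem lift_fin {n : ι → ℕ} (h : PolyComp m x y) (hn : PolyComp m x (fun i => .atom (n i))) :
    PolyComp (ι := Σ i, Fin (n i)) (fun q => m q.1) (fun q => .pair (x q.1) (.atom q.2))
      (fun q => y q.1) :=
  h.lift ((hn.bdd_atom.reindex _).mono fun q => q.2.2.le)

theorem fin_bdd {n : ι → ℕ} (hn : PolyComp m x (fun i => .atom (n i))) :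
    PolyBdd (ι := Σ i, Fin (n i)) (fun q => m q.1) (fun q => q.2) :=
  (hn.bdd_atom.reindex _).mono fun q => q.2.2.le

theorem env_fin {n : ι → ℕ} (hn : PolyComp m x (fun i => .atom (n i))) :
    PolyComp (ι := Σ i, Fin (n i)) (fun q => m q.1) (fun q => .pair (x q.1) (.atom q.2))
      (fun q => .pair (x q.1) (.atom q.2)) :=
  env ((hn.env_bdd.reindex _).max hn.fin_bdd)

/-- The index itself is computable. -/
theorem var_fin {n : ι → ℕ} (hn : PolyComp m x (fun i => .atom (n i))) :
    PolyComp (ι := Σ i, Fin (n i)) (fun q => m q.1) (fun q => .pair (x q.1) (.atom q.2))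
      (fun q => .atom q.2) :=
  hn.env_fin.snd

/-- Iteration with a body that does not depend on the state in any other way. -/
theorem rec' {s : ∀ _ : ι, ℕ → Val} {k : ι → ℕ}
    (hk : PolyComp m x (fun i => .atom (k i))) (h0 : PolyComp m x (fun i => s i 0))
    (hb : PolyBdd (ι := Σ i, Fin (k i)) (fun q => m q.1) (fun q => (s q.1 q.2).top))
    (hs : ∀ {u : (Σ i, Fin (k i)) → Val},
      (∀ {y : ι → Val}, PolyComp m x y → PolyComp (fun q => m q.1) u (fun q => y q.1)) →
      (∀ {y : (Σ i, Fin (k i)) → Val},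
        PolyComp (fun q => m q.1) (fun q => .pair (x q.1) (.atom q.2)) y →
        PolyComp (fun q => m q.1) u y) →
      PolyComp (fun q => m q.1) u (fun q => .atom q.2) →
      PolyComp (fun q => m q.1) u (fun q => s q.1 q.2) →
      PolyComp (fun q => m q.1) u (fun q => s q.1 (q.2 + 1))) :
    PolyComp m x (fun i => s i (k i)) := by
  refine recN hk h0 ?_
  have he : PolyComp (ι := Σ i, Fin (k i)) (fun q => m q.1)
      (fun q => .pair (x q.1) (.pair (.atom q.2) (s q.1 q.2)))
      (fun q => .pair (x q.1) (.pair (.atom q.2) (s q.1 q.2))) :=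
    env ((hk.env_bdd.reindex _).max (hk.fin_bdd.max hb))
  exact hs (fun h => he.fst.comp (h.reindex _)) (fun h => (he.fst.pair he.snd.fst).comp h)
    he.snd.fst he.snd.snd

/-! ### Arithmetic -/

theorem sub {a b : ι → ℕ} (ha : PolyComp m x (fun i => .atom (a i)))
    (hb : PolyComp m x (fun i => .atom (b i))) :
    PolyComp m x (fun i => .atom (a i - b i)) :=
  rec' (s := fun i j => .atom (a i - j)) hb ha ((ha.bdd_atom.reindex _).mono fun q => by simp)
    fun _ _ _ h => h.pred

theorem add {a b : ι → ℕ} (ha : PolyComp m x (fun i => .atom (a i)))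
    (hb : PolyComp m x (fun i => .atom (b i))) :
    PolyComp m x (fun i => .atom (a i + b i)) :=
  rec' (s := fun i j => .atom (a i + j)) hb ha
    (((ha.bdd_atom.add hb.bdd_atom).reindex _).mono fun q => by simp)
    fun _ _ _ h => h.succ

theorem mul {a b : ι → ℕ} (ha : PolyComp m x (fun i => .atom (a i)))
    (hb : PolyComp m x (fun i => .atom (b i))) :
    PolyComp m x (fun i => .atom (a i * b i)) :=
  rec' (s := fun i j => .atom (a i * j)) hb (zero ha.env_bdd)
    (((ha.bdd_atom.mul hb.bdd_atom).reindex _).mono fun q =>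
      Nat.mul_le_mul_left _ q.2.2.le)
    fun hx _ _ h => h.add (hx ha)

/-- A leaf grows by at most one per step, so a power of two is computable in polynomial time only
when its value is polynomially bounded. This is why the bound is a separate hypothesis. -/
theorem two_pow {a : ι → ℕ} (ha : PolyComp m x (fun i => .atom (a i)))
    (hb : PolyBdd m (fun i => 2 ^ a i)) :
    PolyComp m x (fun i => .atom (2 ^ a i)) :=
  rec' (s := fun i j => .atom (2 ^ j)) ha (const ha.env_bdd 1)
    ((hb.reindex _).mono fun q => Nat.pow_le_pow_right (by omega) q.2.2.le)
    fun _ _ _ h => (h.add h).congr fun q => by rw [pow_succ, mul_two]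

/-! ### Logic -/

theorem not {p : ι → Prop} (hp : PolyComp m x (fun i => .ofProp (p i))) :
    PolyComp m x (fun i => .ofProp (¬ p i)) :=
  (ite hp (const hp.env_bdd 0) (const hp.env_bdd 1)).congr fun i => by
    by_cases h : p i <;> simp [Val.ofProp, h]

theorem and {p q : ι → Prop} (hp : PolyComp m x (fun i => .ofProp (p i)))
    (hq : PolyComp m x (fun i => .ofProp (q i))) :
    PolyComp m x (fun i => .ofProp (p i ∧ q i)) :=
  (ite hp hq (const hp.env_bdd 0)).congr fun i => by
    by_cases h : p i <;> by_cases h' : q i <;> simp [Val.ofProp, h, h']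

theorem iff {p q : ι → Prop} (hp : PolyComp m x (fun i => .ofProp (p i)))
    (h : ∀ i, q i ↔ p i) : PolyComp m x (fun i => .ofProp (q i)) :=
  hp.congr fun i => by rw [propext (h i)]

theorem or {p q : ι → Prop} (hp : PolyComp m x (fun i => .ofProp (p i)))
    (hq : PolyComp m x (fun i => .ofProp (q i))) :
    PolyComp m x (fun i => .ofProp (p i ∨ q i)) :=
  (hp.not.and hq.not).not.iff fun i => by tauto

theorem imp {p q : ι → Prop} (hp : PolyComp m x (fun i => .ofProp (p i)))
    (hq : PolyComp m x (fun i => .ofProp (q i))) :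
    PolyComp m x (fun i => .ofProp (p i → q i)) :=
  (hp.not.or hq).iff fun i => by tauto

theorem le {a b : ι → ℕ} (ha : PolyComp m x (fun i => .atom (a i)))
    (hb : PolyComp m x (fun i => .atom (b i))) :
    PolyComp m x (fun i => .ofProp (a i ≤ b i)) :=
  (lt hb ha).not.iff fun i => by simp

theorem eq {a b : ι → ℕ} (ha : PolyComp m x (fun i => .atom (a i)))
    (hb : PolyComp m x (fun i => .atom (b i))) :
    PolyComp m x (fun i => .ofProp (a i = b i)) :=
  ((le ha hb).and (le hb ha)).iff fun i => by omega

theorem fin_eq {n : ι → ℕ} {a b : ∀ i, Fin (n i)} (ha : PolyComp m x (fun i => .atom (a i)))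
    (hb : PolyComp m x (fun i => .atom (b i))) :
    PolyComp m x (fun i => .ofProp (a i = b i)) :=
  (eq ha hb).iff fun _ => Fin.ext_iff

/-! ### Bounded quantifiers, sums and search -/

theorem exists_fin {n : ι → ℕ} {p : ∀ i, Fin (n i) → Prop}
    (hn : PolyComp m x (fun i => .atom (n i)))
    (hp : PolyComp (ι := Σ i, Fin (n i)) (fun q => m q.1)
      (fun q => .pair (x q.1) (.atom q.2)) (fun q => .ofProp (p q.1 q.2))) :
    PolyComp m x (fun i => .ofProp (∃ j, p i j)) := by
  have : PolyComp m x (fun i => .ofProp (∃ j : Fin (n i), j.val < n i ∧ p i j)) :=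
    rec' (s := fun i k => .ofProp (∃ j : Fin (n i), j.val < k ∧ p i j)) hn
      ((const hn.env_bdd 0).congr fun i => by simp [Val.ofProp]) bdd_ofProp
      fun _ hb _ h => (h.or (hb hp)).iff fun q => by
        constructor
        · rintro ⟨j, hj, h⟩
          rcases Nat.lt_succ_iff_lt_or_eq.1 hj with h' | h'
          · exact .inl ⟨j, h', h⟩
          · rw [Fin.ext h'] at h; exact .inr h
        · rintro (⟨j, hj, h⟩ | h)
          · exact ⟨j, by omega, h⟩
          · exact ⟨q.2, by omega, h⟩
  exact this.iff fun i => by simp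

theorem forall_fin {n : ι → ℕ} {p : ∀ i, Fin (n i) → Prop}
    (hn : PolyComp m x (fun i => .atom (n i)))
    (hp : PolyComp (ι := Σ i, Fin (n i)) (fun q => m q.1)
      (fun q => .pair (x q.1) (.atom q.2)) (fun q => .ofProp (p q.1 q.2))) :
    PolyComp m x (fun i => .ofProp (∀ j, p i j)) :=
  (exists_fin (p := fun i j => ¬ p i j) hn hp.not).not.iff fun i => by simp

theorem sum_fin {n : ι → ℕ} {f : ∀ i, Fin (n i) → ℕ}
    (hn : PolyComp m x (fun i => .atom (n i)))
    (hf : PolyComp (ι := Σ i, Fin (n i)) (fun q => m q.1)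
      (fun q => .pair (x q.1) (.atom q.2)) (fun q => .atom (f q.1 q.2))) :
    PolyComp m x (fun i => .atom (∑ j, f i j)) := by
  have : PolyComp m x (fun i => .atom (∑ j : Fin (n i), if j.val < n i then f i j else 0)) := by
    refine rec' (s := fun i k => .atom (∑ j : Fin (n i), if j.val < k then f i j else 0)) hn
      ((const hn.env_bdd 0).congr fun i => by simp) ?_ ?_
    · obtain ⟨c, hc⟩ := hf.bdd_atom
      refine ((hn.bdd_atom.reindex _).mul
        (⟨c, fun q => le_rfl⟩ : PolyBdd _ (fun q : Σ i, Fin (n i) => (m q.1 + 2) ^ c))).mono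
        fun q => ?_
      refine (Finset.sum_le_card_nsmul _ _ ((m q.1 + 2) ^ c) fun j _ => ?_).trans
        (by simp)
      split
      · exact hc ⟨q.1, j⟩
      · simp
    · intro _ _ hb _ h
      refine (h.add (hb hf)).congr fun q => ?_
      congr 1
      have : ∀ j : Fin (n q.1), (if j.val < q.2 + 1 then f q.1 j else 0) =
          (if j.val < q.2 then f q.1 j else 0) + if j = q.2 then f q.1 j else 0 := by
        intro j
        rcases lt_trichotomy j.val q.2.val with h | h | h
        · simp [h, Nat.lt_succ_of_lt h, Fin.ext_iff, h.ne]
        · simp [Fin.ext h]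
        · simp [h.not_gt, show ¬ j.val < q.2.val + 1 by omega, Fin.ext_iff, h.ne']
      simp_rw [this, Finset.sum_add_distrib]
      simp
  exact this.congr fun i => by simp

end PolyComp

/-- Linear search for an element with property `p` among the first `k` indices. -/
noncomputable def pickAux {n : ℕ} (p : Fin n → Prop) (d : Fin n) : ℕ → Fin n
  | 0 => d
  | k + 1 => open Classical in if h : ∃ h : k < n, p ⟨k, h⟩ then ⟨k, h.1⟩ else pickAux p d k

/-- Some element with property `p` if there is one, and `d` otherwise. -/
noncomputable def pick {n : ℕ} (p : Fin n → Prop) (d : Fin n) : Fin n :=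
  pickAux p d n

theorem pick_spec {n : ℕ} {p : Fin n → Prop} {d : Fin n} (h : ∃ j, p j) : p (pick p d) := by
  have : ∀ k, (∃ j : Fin n, j.val < k ∧ p j) → p (pickAux p d k) := by
    intro k
    induction k with
    | zero => simp
    | succ k ih =>
      rintro ⟨j, hj, h⟩
      unfold pickAux
      split
      case isTrue h' => exact h'.2
      case isFalse h' =>
        refine ih ⟨j, ?_, h⟩
        rcases Nat.lt_succ_iff_lt_or_eq.1 hj with h1 | h1
        · exact h1
        · subst h1; exact absurd ⟨j.2, h⟩ h'
  obtain ⟨j, hj⟩ := h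
  exact this n ⟨j, j.2, hj⟩

/-- The table of the values of a function on `Fin n`. -/
def Val.tab {n : ℕ} (f : Fin n → Val) : Val := Val.ofList (List.ofFn f)

/-- The table of a set. -/
noncomputable def Val.setTab {n : ℕ} (p : Fin n → Prop) : Val := Val.tab fun j => .ofProp (p j)

/-- The table of a function. -/
def Val.funTab {n : ℕ} (f : Fin n → ℕ) : Val := Val.tab fun j => .atom (f j)

/-- The table of a binary function. -/
def Val.matTab {n : ℕ} (f : Fin n → Fin n → ℕ) : Val := Val.tab fun i => .funTab (f i)

theorem Val.top_ofList {l : List Val} {b : ℕ} (h : ∀ a ∈ l, a.top ≤ b) : (ofList l).top ≤ b := by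
  induction l with
  | nil => simp [ofList]
  | cons a l ih =>
    simp only [List.mem_cons, forall_eq_or_imp] at h
    simpa [ofList] using ⟨h.1, ih h.2⟩

theorem Val.top_mem_ofList {l : List Val} {a : Val} (h : a ∈ l) : a.top ≤ (ofList l).top := by
  induction l with
  | nil => simp at h
  | cons b l ih =>
    rcases List.mem_cons.1 h with rfl | h
    · simp [ofList]
    · simp [ofList, ih h]

theorem Val.top_tab_le {n b : ℕ} {f : Fin n → Val} (h : ∀ j, (f j).top ≤ b) :
    (tab f).top ≤ b :=
  top_ofList fun a ha => by
    obtain ⟨j, rfl⟩ := (List.mem_ofFn' _ _).1 ha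
    exact h j

theorem PolyBdd.tab {ι : Type} {m : ι → ℕ} {n : ι → ℕ} {f : ∀ i, Fin (n i) → Val}
    (h : PolyBdd (ι := Σ i, Fin (n i)) (fun q => m q.1) (fun q => (f q.1 q.2).top)) :
    PolyBdd m (fun i => (Val.tab (f i)).top) := by
  obtain ⟨c, hc⟩ := h
  exact ⟨c, fun i => Val.top_tab_le fun j => hc ⟨i, j⟩⟩

theorem PolyBdd.funTab {ι : Type} {m : ι → ℕ} {n : ι → ℕ} {f : ∀ i, Fin (n i) → ℕ}
    (h : PolyBdd (ι := Σ i, Fin (n i)) (fun q => m q.1) (fun q => f q.1 q.2)) :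
    PolyBdd m (fun i => (Val.funTab (f i)).top) := tab h

theorem PolyBdd.setTab {ι : Type} {m : ι → ℕ} {n : ι → ℕ} {p : ∀ i, Fin (n i) → Prop} :
    PolyBdd m (fun i => (Val.setTab (p i)).top) := tab PolyComp.bdd_ofProp

/-! ### Computability of search, tabulation and table lookup. -/

namespace PolyComp

variable {ι : Type} {m : ι → ℕ} {x y z : ι → Val}

theorem pick {n : ι → ℕ} {p : ∀ i, Fin (n i) → Prop} {d : ∀ i, Fin (n i)}
    (hn : PolyComp m x (fun i => .atom (n i)))
    (hp : PolyComp (ι := Σ i, Fin (n i)) (fun q => m q.1)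
      (fun q => .pair (x q.1) (.atom q.2)) (fun q => .ofProp (p q.1 q.2)))
    (hd : PolyComp m x (fun i => .atom (d i))) :
    PolyComp m x (fun i => .atom (DetSampling.pick (p i) (d i))) := by
  refine rec' (s := fun i k => .atom (pickAux (p i) (d i) k)) hn hd
    ((hn.bdd_atom.reindex _).mono fun q => (pickAux _ _ _).2.le) ?_
  intro _ _ hb hj h
  refine (ite_atom (hb hp) hj h).congr fun q => ?_
  congr 1
  rw [pickAux]
  by_cases h : p q.1 q.2
  · rw [dif_pos ⟨q.2.2, h⟩, if_pos h]
  · rw [dif_neg (by simpa using h), if_neg h]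

/-- Tabulation of a computable function. -/
theorem tab {n : ι → ℕ} {f : ∀ i, Fin (n i) → Val}
    (hn : PolyComp m x (fun i => .atom (n i)))
    (hf : PolyComp (ι := Σ i, Fin (n i)) (fun q => m q.1)
      (fun q => .pair (x q.1) (.atom q.2)) (fun q => f q.1 q.2)) :
    PolyComp m x (fun i => .tab (f i)) := by
  have : PolyComp m x (fun i => .ofList ((List.ofFn (f i)).drop (n i - n i))) := by
    refine rec' (s := fun i k => .ofList ((List.ofFn (f i)).drop (n i - k))) hn
      ((zero hn.env_bdd).congr fun i => ?_) ?_ ?_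
    · rw [List.drop_eq_nil_of_le (by simp), Val.ofList]
    · refine ((PolyBdd.tab hf.bdd).reindex _).mono fun q => Val.top_ofList fun a ha => ?_
      exact Val.top_mem_ofList (List.mem_of_mem_drop ha)
    · intro u hl hb hj h
      -- Lists grow only at the head, so the table is built from its last entry and round `q.2`
      -- prepends the entry with the reversed index.
      refine PolyComp.congr (((?_ : PolyComp _ u fun q => f q.1 q.2.rev)).pair h) fun q => ?_
      · refine PolyComp.comp ?_ (hf.reindex fun q : (Σ i, Fin (n i)) => ⟨q.1, q.2.rev⟩)
        refine (hl (env hn.env_bdd)).pair ?_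
        exact ((hl hn).sub hj.succ).congr fun q => by simp [Fin.val_rev]
      · have : n q.1 - (q.2 + 1) < (List.ofFn (f q.1)).length := by
          have := q.2.2
          simp only [List.length_ofFn]
          omega
        rw [List.drop_eq_getElem_cons this, Val.ofList]
        have h2 := q.2.2
        rw [show n q.1 - (q.2 + 1) + 1 = n q.1 - q.2 by omega]
        simp only [List.getElem_ofFn]
        congr 2
  exact this.congr fun i => by simp [Val.tab]

theorem setTab {n : ι → ℕ} {p : ∀ i, Fin (n i) → Prop}
    (hn : PolyComp m x (fun i => .atom (n i)))
    (hp : PolyComp (ι := Σ i, Fin (n i)) (fun q => m q.1)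
      (fun q => .pair (x q.1) (.atom q.2)) (fun q => .ofProp (p q.1 q.2))) :
    PolyComp m x (fun i => .setTab (p i)) :=
  tab hn hp

theorem funTab {n : ι → ℕ} {f : ∀ i, Fin (n i) → ℕ}
    (hn : PolyComp m x (fun i => .atom (n i)))
    (hf : PolyComp (ι := Σ i, Fin (n i)) (fun q => m q.1)
      (fun q => .pair (x q.1) (.atom q.2)) (fun q => .atom (f q.1 q.2))) :
    PolyComp m x (fun i => .funTab (f i)) :=
  tab hn hf

/-- Table lookup. -/
theorem get {n : ι → ℕ} {f : ∀ i, Fin (n i) → Val} {a : ∀ i, Fin (n i)}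
    (hf : PolyComp m x (fun i => .tab (f i))) (ha : PolyComp m x (fun i => .atom (a i))) :
    PolyComp m x (fun i => f i (a i)) := by
  have : PolyComp m x (fun i => .ofList ((List.ofFn (f i)).drop (a i))) := by
    refine rec' (s := fun i k => .ofList ((List.ofFn (f i)).drop k)) ha
      (hf.congr fun i => by simp [Val.tab]) ?_ ?_
    · refine (hf.bdd.reindex _).mono fun q => Val.top_ofList fun a ha => ?_
      exact Val.top_mem_ofList (List.mem_of_mem_drop ha)
    · intro u _ _ _ h
      refine (h.congr fun q => ?_ : PolyComp _ u fun q : (Σ i, Fin (a i)) => .pair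
        (f q.1 ⟨q.2, by have := q.2.2; omega⟩) (.ofList ((List.ofFn (f q.1)).drop (q.2 + 1)))).snd
      have : q.2 < (List.ofFn (f q.1)).length := by
        have := q.2.2
        simp only [List.length_ofFn]
        omega
      rw [List.drop_eq_getElem_cons this, Val.ofList]
      simp
  refine PolyComp.fst (z := fun i => .ofList ((List.ofFn (f i)).drop (a i + 1)))
    (this.congr fun i => ?_)
  have : (a i).val < (List.ofFn (f i)).length := by simp
  rw [List.drop_eq_getElem_cons this, Val.ofList]
  simp

theorem get_set {n : ι → ℕ} {p : ∀ i, Fin (n i) → Prop} {a : ∀ i, Fin (n i)}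
    (hp : PolyComp m x (fun i => .setTab (p i))) (ha : PolyComp m x (fun i => .atom (a i))) :
    PolyComp m x (fun i => .ofProp (p i (a i))) :=
  get (f := fun i j => .ofProp (p i j)) hp ha

theorem get_fun {n : ι → ℕ} {f : ∀ i, Fin (n i) → ℕ} {a : ∀ i, Fin (n i)}
    (hf : PolyComp m x (fun i => .funTab (f i))) (ha : PolyComp m x (fun i => .atom (a i))) :
    PolyComp m x (fun i => .atom (f i (a i))) :=
  get (f := fun i j => .atom (f i j)) hf ha

theorem get_mat {n : ι → ℕ} {f : ∀ i, Fin (n i) → Fin (n i) → ℕ} {a b : ∀ i, Fin (n i)}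
    (hf : PolyComp m x (fun i => .matTab (f i))) (ha : PolyComp m x (fun i => .atom (a i)))
    (hb : PolyComp m x (fun i => .atom (b i))) :
    PolyComp m x (fun i => .atom (f i (a i) (b i))) :=
  get_fun (f := fun i => f i (a i)) (get (f := fun i j => .funTab (f i j)) hf ha) hb

end PolyComp

/-! ## Reachability and maximum flows -/

section Flow

variable {M : ℕ}

/-- `u` reaches the sinks in at most `k` steps along arcs of positive capacity. -/
def ReachIn (c : Fin M → Fin M → ℕ) (snk : Fin M → Prop) : ℕ → Fin M → Prop
  | 0, u => snk u
  | k + 1, u => ReachIn c snk k u ∨ ∃ w, 0 < c u w ∧ ReachIn c snk k w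

/-- `u` reaches the sinks along arcs of positive capacity. -/
def CanReach (c : Fin M → Fin M → ℕ) (snk : Fin M → Prop) (u : Fin M) : Prop :=
  ReachIn c snk M u

theorem ReachIn.mono {c : Fin M → Fin M → ℕ} {snk : Fin M → Prop} {k l : ℕ} (h : k ≤ l)
    {u : Fin M} (hu : ReachIn c snk k u) : ReachIn c snk l u := by
  induction h with
  | refl => exact hu
  | step _ ih => exact .inl ih

theorem ReachIn.stable {c : Fin M → Fin M → ℕ} {snk : Fin M → Prop} {k : ℕ}
    (h : ∀ u, ReachIn c snk (k + 1) u → ReachIn c snk k u) {l : ℕ} (hl : k ≤ l) {u : Fin M}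
    (hu : ReachIn c snk l u) : ReachIn c snk k u := by
  induction hl generalizing u with
  | refl => exact hu
  | step _ ih =>
    rcases hu with hu | ⟨w, hw, hu⟩
    · exact ih hu
    · exact h u (.inr ⟨w, hw, ih hu⟩)

/-- The sets of nodes reached within k steps increase with k. Once two consecutive ones agree they
are constant, and strict growth can last for at most M rounds. -/
theorem ReachIn.canReach {c : Fin M → Fin M → ℕ} {snk : Fin M → Prop} {k : ℕ} {u : Fin M}
    (hu : ReachIn c snk k u) : CanReach c snk u := by
  classical
  have key : ∀ k, (∃ l ≤ k, ∀ u, ReachIn c snk (l + 1) u → ReachIn c snk l u) ∨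
      k < (Finset.univ.filter (ReachIn c snk (k + 1))).card := by
    intro k
    induction k with
    | zero =>
      by_cases h : ∀ u, ReachIn c snk 1 u → ReachIn c snk 0 u
      · exact .inl ⟨0, le_rfl, h⟩
      · push Not at h
        obtain ⟨u, hu, -⟩ := h
        exact .inr (Finset.card_pos.2 ⟨u, by simpa using hu⟩)
    | succ k ih =>
      rcases ih with ⟨l, hl, h⟩ | ih
      · exact .inl ⟨l, by omega, h⟩
      · by_cases h : ∀ u, ReachIn c snk (k + 1 + 1) u → ReachIn c snk (k + 1) u
        · exact .inl ⟨k + 1, le_rfl, h⟩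
        · push Not at h
          obtain ⟨u, hu, hu'⟩ := h
          refine .inr (lt_of_le_of_lt ih (Finset.card_lt_card ⟨fun v hv => ?_, fun h => ?_⟩))
          · simp only [Finset.mem_filter, Finset.mem_univ, true_and] at hv ⊢
            exact .inl hv
          · exact hu' (by simpa using h (by simpa using hu))
  rcases key M with ⟨l, hl, h⟩ | h
  · rcases le_total k l with hk | hk
    · exact (hu.mono hk).mono hl
    · exact (ReachIn.stable h hk hu).mono hl
  · exact absurd h (by simpa using Finset.card_le_univ (α := Fin M) _)

theorem CanReach.step {c : Fin M → Fin M → ℕ} {snk : Fin M → Prop} {u w : Fin M}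
    (h : 0 < c u w) (hw : CanReach c snk w) : CanReach c snk u :=
  ReachIn.canReach (k := M + 1) (.inr ⟨w, h, hw⟩)

theorem canReach_iff {c : Fin M → Fin M → ℕ} {snk : Fin M → Prop} {u : Fin M} :
    CanReach c snk u ↔ ∃ t, snk t ∧ Relation.ReflTransGen (fun a b => 0 < c a b) u t := by
  constructor
  · have : ∀ k u, ReachIn c snk k u →
        ∃ t, snk t ∧ Relation.ReflTransGen (fun a b => 0 < c a b) u t := by
      intro k
      induction k with
      | zero => exact fun u hu => ⟨u, hu, .refl⟩
      | succ k ih =>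
        rintro u (hu | ⟨w, hw, hu⟩)
        · exact ih u hu
        · obtain ⟨t, ht, h⟩ := ih w hu
          exact ⟨t, ht, .head hw h⟩
    exact this M u
  · rintro ⟨t, ht, h⟩
    induction h using Relation.ReflTransGen.head_induction_on with
    | refl => exact ReachIn.canReach (k := 0) ht
    | head h _ ih => exact ih.step h

open Classical in
/-- The distance from `u` to the sinks, cut off at the number of nodes. -/
noncomputable def sinkDist (c : Fin M → Fin M → ℕ) (snk : Fin M → Prop) (u : Fin M) : ℕ :=
  ∑ k : Fin M, if ReachIn c snk k u then 0 else 1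

theorem sinkDist_le {c : Fin M → Fin M → ℕ} {snk : Fin M → Prop} {u : Fin M} :
    sinkDist c snk u ≤ M := by
  classical
  refine (Finset.sum_le_card_nsmul _ _ 1 fun k _ => ?_).trans (by simp)
  split <;> simp

theorem sinkDist_le_of_reachIn {c : Fin M → Fin M → ℕ} {snk : Fin M → Prop} {u : Fin M} {k : ℕ}
    (h : ReachIn c snk k u) : sinkDist c snk u ≤ k := by
  classical
  unfold sinkDist
  calc _ ≤ ∑ l : Fin M, if l.val < k then 1 else 0 := by
        refine Finset.sum_le_sum fun l _ => ?_
        by_cases hl : l.val < k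
        · simp only [hl, if_true]
          split <;> simp
        · simp [h.mono (not_lt.1 hl)]
    _ = (Finset.univ.filter fun l : Fin M => l.val < k).card := by simp
    _ ≤ (Finset.range k).card :=
        Finset.card_le_card_of_injOn (fun l => l.val) (fun l hl => by simpa using hl)
          (fun a _ b _ h => Fin.ext h)
    _ = k := by simp

theorem lt_sinkDist_of_not_reachIn {c : Fin M → Fin M → ℕ} {snk : Fin M → Prop} {u : Fin M}
    {k : ℕ} (hk : k < M) (h : ¬ ReachIn c snk k u) : k < sinkDist c snk u := by
  classical
  unfold sinkDist
  calc k < (Finset.Iic (⟨k, hk⟩ : Fin M)).card := by simp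
    _ = ∑ l : Fin M, if l ≤ ⟨k, hk⟩ then 1 else 0 := by
        rw [← Finset.card_filter]
        congr 1
        ext l
        simp
    _ ≤ _ := by
        refine Finset.sum_le_sum fun l _ => ?_
        by_cases hl : l ≤ ⟨k, hk⟩
        · have : ¬ ReachIn c snk l u := fun h' => h (h'.mono hl)
          simp [hl, this]
        · simp [hl]

/-- Take the least k for which u reaches the sinks in k steps; the first arc of such a walk leads to
a node at distance less than k. -/
theorem exists_closer {c : Fin M → Fin M → ℕ} {snk : Fin M → Prop} {u : Fin M}
    (h : CanReach c snk u) (h0 : sinkDist c snk u ≠ 0) :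
    ∃ w, 0 < c u w ∧ sinkDist c snk w < sinkDist c snk u := by
  classical
  have hex : ∃ k, ReachIn c snk k u := ⟨M, h⟩
  obtain ⟨k, hk⟩ : ∃ k, Nat.find hex = k := ⟨_, rfl⟩
  have h1 : ReachIn c snk k u := hk ▸ Nat.find_spec hex
  have hM : k ≤ M := hk ▸ Nat.find_min' hex h
  cases k with
  | zero => exact absurd (Nat.le_zero.1 (sinkDist_le_of_reachIn h1)) h0
  | succ k =>
    have h2 : ¬ ReachIn c snk k u := Nat.find_min hex (by omega)
    rcases h1 with h1 | ⟨w, hw, h1⟩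
    · exact absurd h1 h2
    · exact ⟨w, hw, (sinkDist_le_of_reachIn h1).trans_lt
        (lt_sinkDist_of_not_reachIn (by omega) h2)⟩

open Classical in
/-- The capacity of the cut of a node set. -/
noncomputable def cutCap (c : Fin M → Fin M → ℕ) (C : Finset (Fin M)) : ℕ :=
  ∑ u, ∑ w, if u ∈ C ∧ w ∉ C then c u w else 0

/-- `C` contains the sources and no sinks. -/
def IsCutSide (src snk : Fin M → Prop) (C : Finset (Fin M)) : Prop :=
  (∀ u, src u → u ∈ C) ∧ ∀ u, snk u → u ∉ C

/-- The inequality holds for each arc separately, by the positions of its two ends with respect to A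
and B. -/
theorem cutCap_submodular (c : Fin M → Fin M → ℕ) (A B : Finset (Fin M)) :
    cutCap c (A ∪ B) + cutCap c (A ∩ B) ≤ cutCap c A + cutCap c B := by
  unfold cutCap
  simp only [← Finset.sum_add_distrib]
  refine Finset.sum_le_sum fun u _ => Finset.sum_le_sum fun w _ => ?_
  by_cases h1 : u ∈ A <;> by_cases h2 : u ∈ B <;> by_cases h3 : w ∈ A <;> by_cases h4 : w ∈ B <;>
    simp [h1, h2, h3, h4]

theorem cutCap_mono {c c' : Fin M → Fin M → ℕ} (h : ∀ u w, c u w ≤ c' u w)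
    (C : Finset (Fin M)) : cutCap c C ≤ cutCap c' C :=
  Finset.sum_le_sum fun u _ => Finset.sum_le_sum fun w _ => by split <;> simp [h u w]

theorem cutCap_add (c c' : Fin M → Fin M → ℕ) (C : Finset (Fin M)) :
    cutCap (fun u w => c u w + c' u w) C = cutCap c C + cutCap c' C := by
  unfold cutCap
  simp only [← Finset.sum_add_distrib]
  refine Finset.sum_congr rfl fun u _ => Finset.sum_congr rfl fun w _ => ?_
  split <;> simp

/-- One unit on the arc from `a` to `b`. -/
noncomputable def unitArc (a b : Fin M) (u w : Fin M) : ℕ := if u = a ∧ w = b then 1 else 0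

open Classical in
theorem cutCap_unitArc (a b : Fin M) (C : Finset (Fin M)) :
    cutCap (unitArc a b) C = if a ∈ C ∧ b ∉ C then 1 else 0 := by
  unfold cutCap unitArc
  rw [Finset.sum_eq_single a, Finset.sum_eq_single b]
  · simp
  · intro w _ h; simp [h]
  · simp
  · intro u _ h; simp [h]
  · simp

theorem le_cutCap {c : Fin M → Fin M → ℕ} {C : Finset (Fin M)} {u w : Fin M} (hu : u ∈ C)
    (hw : w ∉ C) : c u w ≤ cutCap c C := by
  unfold cutCap
  refine le_trans ?_ (Finset.single_le_sum (f := fun u => ∑ w, if u ∈ C ∧ w ∉ C then c u w else 0)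
    (fun _ _ => Nat.zero_le _) (Finset.mem_univ u))
  refine le_trans ?_ (Finset.single_le_sum (f := fun w => if u ∈ C ∧ w ∉ C then c u w else 0)
    (fun _ _ => Nat.zero_le _) (Finset.mem_univ w))
  simp [hu, hw]

/-- An out-neighbour of `u` that is closer to the sinks. -/
noncomputable def closerNode (c : Fin M → Fin M → ℕ) (snk : Fin M → Prop) (u : Fin M) : Fin M :=
  pick (fun w => 0 < c u w ∧ sinkDist c snk w < sinkDist c snk u) u

theorem closerNode_spec {c : Fin M → Fin M → ℕ} {snk : Fin M → Prop} {u : Fin M}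
    (h : CanReach c snk u) (h0 : sinkDist c snk u ≠ 0) :
    0 < c u (closerNode c snk u) ∧ sinkDist c snk (closerNode c snk u) < sinkDist c snk u :=
  pick_spec (exists_closer h h0)

/-- One arc of an augmentation along a shortest path to the sinks. The state consists of the
residual capacities and the head of the path. -/
noncomputable def pushStep (c : Fin M → Fin M → ℕ) (snk : Fin M → Prop)
    (s : (Fin M → Fin M → ℕ) × Fin M) : (Fin M → Fin M → ℕ) × Fin M :=
  if sinkDist c snk s.2 = 0 then s
  else
    (fun a b => s.1 a b + unitArc (closerNode c snk s.2) s.2 a b -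
      unitArc s.2 (closerNode c snk s.2) a b, closerNode c snk s.2)

/-- The state of the augmentation after `j` arcs. -/
noncomputable def pushPath (c : Fin M → Fin M → ℕ) (snk : Fin M → Prop) (u : Fin M) (j : ℕ) :
    (Fin M → Fin M → ℕ) × Fin M :=
  (pushStep c snk)^[j] (c, u)

theorem pushPath_succ (c : Fin M → Fin M → ℕ) (snk : Fin M → Prop) (u : Fin M) (j : ℕ) :
    pushPath c snk u (j + 1) = pushStep c snk (pushPath c snk u j) :=
  Function.iterate_succ_apply' ..

-- Moving the head from u along arcs changes each cut only according to the sides on which u and the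
-- current head lie, because the interior contributions of the path telescope. Since the distance to
-- the sinks drops strictly along the path, arcs leaving nodes no further than the head have not
-- been reduced yet. This third clause guarantees that the next arc still has capacity for one unit.
open Classical in
theorem pushPath_spec {c : Fin M → Fin M → ℕ} {snk : Fin M → Prop} {u : Fin M}
    (hu : CanReach c snk u) (j : ℕ) :
    CanReach c snk (pushPath c snk u j).2 ∧
    (sinkDist c snk (pushPath c snk u j).2 = 0 ∨
      sinkDist c snk (pushPath c snk u j).2 + j ≤ M) ∧
    (∀ a b, sinkDist c snk a ≤ sinkDist c snk (pushPath c snk u j).2 →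
      c a b ≤ (pushPath c snk u j).1 a b) ∧
    ∀ C : Finset (Fin M), cutCap (pushPath c snk u j).1 C + (if u ∈ C then 1 else 0) =
      cutCap c C + if (pushPath c snk u j).2 ∈ C then 1 else 0 := by
  induction j with
  | zero => exact ⟨hu, .inr sinkDist_le, fun _ _ _ => le_rfl, fun _ => rfl⟩
  | succ j ih =>
    rw [pushPath_succ]
    generalize pushPath c snk u j = s at ih
    obtain ⟨ih1, ih2, ih3, ih4⟩ := ih
    unfold pushStep
    split
    case isTrue h0 => exact ⟨ih1, .inl h0, ih3, ih4⟩
    case isFalse h0 =>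
      obtain ⟨hw1, hw2⟩ := closerNode_spec ih1 h0
      generalize closerNode c snk s.2 = w at hw1 hw2
      have hne : w ≠ s.2 := by rintro rfl; omega
      refine ⟨?_, ?_, ?_, ?_⟩
      · dsimp only
        -- A node that cannot reach the sinks has the cut-off distance M, whereas w is strictly
        -- closer than the old head.
        obtain ⟨t, ht, h⟩ := canReach_iff.1 ih1
        by_contra hcon
        have h3 := sinkDist_le (c := c) (snk := snk) (u := s.2)
        have := lt_sinkDist_of_not_reachIn (c := c) (snk := snk) (u := w) (k := M - 1) (by omega)
          (fun h => hcon h.canReach)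
        omega
      · right
        dsimp only
        omega
      · intro a b hab
        dsimp only at hab ⊢
        have := ih3 a b (by omega)
        have h2 : unitArc s.2 w a b = 0 := by
          unfold unitArc
          rw [if_neg]
          rintro ⟨rfl, -⟩
          omega
        omega
      · intro C
        dsimp only
        have h1 : ∀ a b, s.1 a b + unitArc w s.2 a b - unitArc s.2 w a b + unitArc s.2 w a b =
            s.1 a b + unitArc w s.2 a b := by
          intro a b
          refine Nat.sub_add_cancel ?_
          unfold unitArc
          split
          case isTrue h =>
            have := ih3 s.2 w le_rfl
            rw [h.1, h.2]
            omega
          case isFalse => simp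
        have h2 := cutCap_add (fun a b => s.1 a b + unitArc w s.2 a b - unitArc s.2 w a b)
          (unitArc s.2 w) C
        simp only [h1] at h2
        rw [cutCap_add, cutCap_unitArc, cutCap_unitArc] at h2
        have h3 := ih4 C
        by_cases h4 : w ∈ C <;> by_cases h5 : s.2 ∈ C <;> simp only [h4, h5, true_and, false_and,
          not_true, not_false_eq_true, if_true, if_false] at h2 h3 ⊢ <;> omega

theorem cutCap_pushPath {c : Fin M → Fin M → ℕ} {snk : Fin M → Prop} {u : Fin M}
    (hu : CanReach c snk u) {C : Finset (Fin M)} (huC : u ∈ C) (hC : ∀ t, snk t → t ∉ C) :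
    cutCap (pushPath c snk u M).1 C + 1 = cutCap c C := by
  obtain ⟨h1, h2, -, h3⟩ := pushPath_spec hu M
  have h0 : sinkDist c snk (pushPath c snk u M).2 = 0 := by omega
  have h4 : snk (pushPath c snk u M).2 := by
    by_contra h
    have := lt_sinkDist_of_not_reachIn (c := c) (snk := snk) (k := 0) u.pos h
    omega
  simpa [huC, hC _ h4] using h3 C

open Classical in
/-- One augmentation of the flow; `d` is an arbitrary node. -/
noncomputable def augment (src snk : Fin M → Prop) (d : Fin M) (c : Fin M → Fin M → ℕ) :
    Fin M → Fin M → ℕ :=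
  let u := pick (fun u => src u ∧ CanReach c snk u) d
  if src u ∧ CanReach c snk u then (pushPath c snk u M).1 else c

/-- The residual capacities after at most `k` augmentations. -/
noncomputable def residual (src snk : Fin M → Prop) (d : Fin M) (c : Fin M → Fin M → ℕ) (k : ℕ) :
    Fin M → Fin M → ℕ :=
  (augment src snk d)^[k] c

theorem residual_succ (src snk : Fin M → Prop) (d : Fin M) (c : Fin M → Fin M → ℕ) (k : ℕ) :
    residual src snk d c (k + 1) = augment src snk d (residual src snk d c k) :=
  Function.iterate_succ_apply' ..

/-- Each successful augmentation lowers every cut between sources and sinks by exactly one, so l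
counts the successful ones. If one attempt fails, the network no longer changes. -/
theorem residual_spec (src snk : Fin M → Prop) (d : Fin M) (c : Fin M → Fin M → ℕ) (k : ℕ) :
    ∃ l, (∀ C, IsCutSide src snk C → cutCap (residual src snk d c k) C + l = cutCap c C) ∧
      ((∀ u, src u → ¬ CanReach (residual src snk d c k) snk u) ∨ l = k) := by
  induction k with
  | zero => exact ⟨0, fun _ _ => rfl, .inr rfl⟩
  | succ k ih =>
    obtain ⟨l, h1, h2⟩ := ih
    rw [residual_succ]
    generalize residual src snk d c k = f at h1 h2
    by_cases h : ∃ u, src u ∧ CanReach f snk u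
    · have hl : l = k := h2.resolve_left fun h' => by
        obtain ⟨u, hu⟩ := h
        exact h' u hu.1 hu.2
      have hu := pick_spec (d := d) h
      refine ⟨l + 1, fun C hC => ?_, .inr (by omega)⟩
      rw [← h1 C hC, augment, if_pos hu, ← cutCap_pushPath hu.2 (hC.1 _ hu.1) hC.2]
      omega
    · have hf : augment src snk d f = f := by
        unfold augment
        rw [if_neg]
        exact fun h' => h ⟨_, h'⟩
      rw [hf]
      exact ⟨l, h1, .inl fun u hu hr => h ⟨u, hu, hr⟩⟩

open Classical in
/-- The nodes that do not reach the sinks in the residual network. -/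
noncomputable def furthestSide (src snk : Fin M → Prop) (d : Fin M) (c : Fin M → Fin M → ℕ)
    (k : ℕ) : Finset (Fin M) :=
  Finset.univ.filter fun u => ¬ CanReach (residual src snk d c k) snk u

/-- If some cut has capacity less than `k`, then `furthestSide` is a minimum cut that contains all
the other minimum cuts. -/
theorem furthestSide_spec {src snk : Fin M → Prop} (d : Fin M) {c : Fin M → Fin M → ℕ} {k : ℕ}
    {C₀ : Finset (Fin M)} (h0 : IsCutSide src snk C₀) (hk : cutCap c C₀ < k) :
    IsCutSide src snk (furthestSide src snk d c k) ∧
    ∀ C, IsCutSide src snk C → cutCap c (furthestSide src snk d c k) ≤ cutCap c C ∧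
      (cutCap c C ≤ cutCap c (furthestSide src snk d c k) →
        C ⊆ furthestSide src snk d c k) := by
  classical
  obtain ⟨l, h1, h2⟩ := residual_spec src snk d c k
  -- If a source still reached the sinks, all k augmentations would have succeeded, and the cut C₀
  -- would have lost more than its capacity.
  have hno : ∀ u, src u → ¬ CanReach (residual src snk d c k) snk u := by
    refine h2.resolve_right ?_
    rintro rfl
    have := h1 C₀ h0
    omega
  have hside : IsCutSide src snk (furthestSide src snk d c k) := by
    refine ⟨fun u hu => by simpa [furthestSide] using hno u hu, fun u hu => ?_⟩
    simpa [furthestSide] using ReachIn.canReach (k := 0) (c := residual src snk d c k) hu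
  have hzero : cutCap (residual src snk d c k) (furthestSide src snk d c k) = 0 := by
    unfold cutCap
    refine Finset.sum_eq_zero fun u _ => Finset.sum_eq_zero fun w _ => ?_
    split
    case isTrue h =>
      by_contra h'
      simp only [furthestSide, Finset.mem_filter, Finset.mem_univ, true_and, not_not] at h
      exact h.1 (h.2.step (Nat.pos_of_ne_zero h'))
    case isFalse => rfl
  refine ⟨hside, fun C hC => ?_⟩
  have h3 := h1 C hC
  have h4 := h1 _ hside
  refine ⟨by omega, fun h5 => ?_⟩
  have h6 : cutCap (residual src snk d c k) C = 0 := by omega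
  -- No residual arc leaves a minimum cut C, so nodes that reach the sinks lie outside C. Hence C is
  -- contained in the set of nodes that do not reach them.
  have h7 : ∀ j u, ReachIn (residual src snk d c k) snk j u → u ∉ C := by
    intro j
    induction j with
    | zero => exact hC.2
    | succ j ih =>
      rintro u (hu | ⟨w, hw, hu⟩)
      · exact ih u hu
      · intro huC
        have := le_cutCap (c := residual src snk d c k) huC (ih w hu)
        omega
  intro u hu
  simp only [furthestSide, Finset.mem_filter, Finset.mem_univ, true_and]
  exact fun h => h7 M u h hu

end Flow

/-! ## Enumeration of the important separators -/

section Branching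

variable {n : ℕ}

/-- The entry node of a vertex in the split network. -/
def inNode (v : Fin n) : Fin (n * 2) := finProdFinEquiv (v, 0)

/-- The exit node of a vertex in the split network. -/
def outNode (v : Fin n) : Fin (n * 2) := finProdFinEquiv (v, 1)

@[simp] theorem divNat_inNode (v : Fin n) : (inNode v).divNat = v :=
  congrArg Prod.fst (finProdFinEquiv.symm_apply_apply (v, (0 : Fin 2)))

@[simp] theorem modNat_inNode (v : Fin n) : (inNode v).modNat = 0 :=
  congrArg Prod.snd (finProdFinEquiv.symm_apply_apply (v, (0 : Fin 2)))

@[simp] theorem divNat_outNode (v : Fin n) : (outNode v).divNat = v :=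
  congrArg Prod.fst (finProdFinEquiv.symm_apply_apply (v, (1 : Fin 2)))

@[simp] theorem modNat_outNode (v : Fin n) : (outNode v).modNat = 1 :=
  congrArg Prod.snd (finProdFinEquiv.symm_apply_apply (v, (1 : Fin 2)))

theorem eq_inNode {u : Fin (n * 2)} (h : u.modNat = 0) : u = inNode u.divNat := by
  have : finProdFinEquiv (u.divNat, u.modNat) = u := finProdFinEquiv.apply_symm_apply u
  rw [h] at this
  exact this.symm

theorem sum_nodes (g : Fin (n * 2) → ℕ) : ∑ u, g u = ∑ v, (g (inNode v) + g (outNode v)) := by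
  rw [← Equiv.sum_comp finProdFinEquiv, Fintype.sum_prod_type]
  simp [Fin.sum_univ_two, inNode, outNode]

variable (G : Digraph (Fin n)) (W T : Finset (Fin n)) (p : ℕ)

open Classical in
/-- The cost of deleting `v` when `X` is already deleted and `A` has to be kept. -/
noncomputable def vertexCap (X A : Finset (Fin n)) (v : Fin n) : ℕ :=
  if v ∈ X then 0 else if v ∈ W ∨ v ∈ A then p + 1 else 1

open Classical in
/-- The capacities of the split network. -/
noncomputable def netCap (X A : Finset (Fin n)) (u w : Fin (n * 2)) : ℕ :=
  if u.modNat = 0 then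
    if w.modNat = 1 ∧ u.divNat = w.divNat then vertexCap W p X A u.divNat else 0
  else if w.modNat = 0 ∧ G.Adj u.divNat w.divNat then p + 1 else 0

/-- The entry nodes of the vertices of a set. -/
def IsEntry (A : Finset (Fin n)) (u : Fin (n * 2)) : Prop := u.modNat = 0 ∧ u.divNat ∈ A

/-- The furthest minimum cut of the split network. -/
noncomputable def branchSide (v : Fin n) (s : Finset (Fin n) × Finset (Fin n)) :
    Finset (Fin (n * 2)) :=
  furthestSide (IsEntry s.2) (IsEntry T) (inNode v) (netCap G W p s.1 s.2) (p + 1)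

/-- `x` is a vertex of the furthest minimum cut. -/
def IsCrossing (v : Fin n) (s : Finset (Fin n) × Finset (Fin n)) (x : Fin n) : Prop :=
  inNode x ∈ branchSide G W T p v s ∧ outNode x ∉ branchSide G W T p v s ∧ x ∉ s.1

open Classical in
/-- One branching step: a vertex of the furthest minimum cut is added to the separator or to the
source side. -/
noncomputable def branchStep (v : Fin n) (bit : Prop) (s : Finset (Fin n) × Finset (Fin n)) :
    Finset (Fin n) × Finset (Fin n) :=
  let x := pick (IsCrossing G W T p v s) v
  (if IsCrossing G W T p v s x ∧ bit then insert x s.1 else s.1,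
    if IsCrossing G W T p v s x ∧ ¬ bit then insert x s.2 else s.2)

/-- The state after `j` branching steps, with decisions given by the binary digits of `b`. -/
noncomputable def branchState (v : Fin n) (b : ℕ) : ℕ → Finset (Fin n) × Finset (Fin n)
  | 0 => (∅, {v})
  | j + 1 => branchStep G W T p v (b.testBit j = true) (branchState v b j)

variable {G W T p}

open Classical in
theorem cutCap_netCap (X A : Finset (Fin n)) (C : Finset (Fin (n * 2))) :
    cutCap (netCap G W p X A) C =
      (∑ v, if inNode v ∈ C ∧ outNode v ∉ C then vertexCap W p X A v else 0) +
      ∑ v, ∑ w, if outNode v ∈ C ∧ inNode w ∉ C ∧ G.Adj v w then p + 1 else 0 := by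
  unfold cutCap
  rw [sum_nodes, Finset.sum_add_distrib]
  congr 1
  · refine Finset.sum_congr rfl fun v _ => ?_
    rw [sum_nodes, Finset.sum_eq_single v]
    · simp [netCap]
    · intro w _ h
      simp [netCap, h.symm]
    · simp
  · refine Finset.sum_congr rfl fun v _ => ?_
    rw [sum_nodes]
    refine Finset.sum_congr rfl fun w _ => ?_
    by_cases h1 : outNode v ∈ C <;> by_cases h2 : inNode w ∈ C <;> simp [netCap, h1, h2]

open Classical in
theorem card_crossing_le (X A : Finset (Fin n)) (C : Finset (Fin (n * 2))) :
    (Finset.univ.filter fun u => inNode u ∈ C ∧ outNode u ∉ C ∧ u ∉ X).card ≤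
      cutCap (netCap G W p X A) C := by
  rw [cutCap_netCap, Finset.card_filter]
  refine le_add_right (Finset.sum_le_sum fun v _ => ?_)
  by_cases h1 : inNode v ∈ C <;> by_cases h2 : outNode v ∈ C <;> by_cases h3 : v ∈ X <;>
    simp [vertexCap, h1, h2, h3]
  split <;> omega

theorem vertexCap_le_cutCap {X A : Finset (Fin n)} {C : Finset (Fin (n * 2))} {u : Fin n}
    (h1 : inNode u ∈ C) (h2 : outNode u ∉ C) :
    vertexCap W p X A u ≤ cutCap (netCap G W p X A) C := by
  simpa [netCap] using le_cutCap (c := netCap G W p X A) h1 h2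

theorem inNode_mem_of_adj {X A : Finset (Fin n)} {C : Finset (Fin (n * 2))} {u w : Fin n}
    (hC : cutCap (netCap G W p X A) C ≤ p) (h1 : outNode u ∈ C) (h : G.Adj u w) :
    inNode w ∈ C := by
  by_contra h2
  have := le_cutCap (c := netCap G W p X A) h1 h2
  simp [netCap, h] at this
  omega

open Classical in
/-- A cheap cut of the split network yields a separator. -/
theorem isSeparator_of_cut {X A : Finset (Fin n)} {C : Finset (Fin (n * 2))} {v : Fin n}
    (hvA : v ∈ A) (hC : IsCutSide (IsEntry A) (IsEntry T) C)
    (hp : cutCap (netCap G W p X A) C ≤ p) (hXW : Disjoint X W) (hXT : Disjoint X T)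
    (hvX : v ∉ X) (hT : T.Nonempty) (hvT : v ∉ T) :
    IsSeparator G W {v} T (X ∪ Finset.univ.filter fun u => inNode u ∈ C ∧ outNode u ∉ C ∧ u ∉ X) := by
  -- Vertices of W and A cost p + 1, more than the whole cut, so unless already deleted they cannot
  -- be cut.
  have key : ∀ u, inNode u ∈ C → outNode u ∉ C → u ∉ X → u ∉ W ∧ u ∉ A := by
    intro u h1 h2 h3
    have := vertexCap_le_cutCap (G := G) (W := W) (p := p) (X := X) (A := A) h1 h2
    unfold vertexCap at this
    rw [if_neg h3] at this
    split at this
    case isTrue => omega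
    case isFalse h => tauto
  refine ⟨by simp, hT, by simpa using hvT, ?_, ?_, ?_, ?_⟩
  · simp only [Finset.disjoint_singleton_right, Finset.mem_union, Finset.mem_filter, not_or]
    exact ⟨hvX, fun h => (key v h.2.1 h.2.2.1 h.2.2.2).2 hvA⟩
  · refine Finset.disjoint_union_left.2 ⟨hXT, Finset.disjoint_left.2 fun u hu hT => ?_⟩
    exact hC.2 (inNode u) ⟨by simp, by simpa using hT⟩ (Finset.mem_filter.1 hu).2.1
  · refine Finset.disjoint_union_left.2 ⟨hXW, Finset.disjoint_left.2 fun u hu hW => ?_⟩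
    have := (Finset.mem_filter.1 hu).2
    exact (key u this.1 this.2.1 this.2.2).1 hW
  · intro x hx t ht hr
    obtain rfl := Finset.mem_singleton.1 hx
    have h0 : inNode x ∈ C := hC.1 _ ⟨by simp, by simpa using hvA⟩
    have : ∀ u, u ∉ (X ∪ Finset.univ.filter fun u => inNode u ∈ C ∧ outNode u ∉ C ∧ u ∉ X) →
        inNode u ∈ C → outNode u ∈ C := by
      intro u hu h
      simp only [Finset.mem_union, Finset.mem_filter, Finset.mem_univ, true_and, not_or] at hu
      tauto
    have hend : inNode t ∈ C ∧ outNode t ∈ C := by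
      clear ht
      obtain ⟨hx, hr⟩ := hr
      induction hr with
      | refl => exact ⟨h0, this _ hx h0⟩
      | tail _ hb ih =>
        have hin := inNode_mem_of_adj hp ih.2 hb.1
        exact ⟨hin, this _ hb.2 hin⟩
    exact hC.2 (inNode t) ⟨by simp, by simpa using ht⟩ hend.1

/-! ### Important separators survive the branching -/

variable {v : Fin n} {S : Finset (Fin n)}

theorem mem_reachSet_singleton {u : Fin n} : u ∈ reachSet G S {v} ↔ Reaches G S v u := by
  simp [reachSet]

theorem Reaches.notMem {u : Fin n} (h : Reaches G S v u) : u ∉ S := by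
  obtain ⟨h0, h⟩ := h
  cases h with
  | refl => exact h0
  | tail _ h => exact h.2

theorem Reaches.adj {u w : Fin n} (h : Reaches G S v u) (ha : G.Adj u w) (hw : w ∉ S) :
    Reaches G S v w :=
  ⟨h.1, h.2.tail ⟨ha, hw⟩⟩

/-- If no reachable vertex had an arc to s, then a path avoiding S \ {s} could never enter s, and S
\ {s} would still be a separator, against minimality. -/
theorem IsMinimalSeparator.exists_adj (hS : IsMinimalSeparator G W {v} T S) {s : Fin n}
    (hs : s ∈ S) : ∃ u, Reaches G S v u ∧ G.Adj u s := by
  by_contra! hcon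
  have hsub := Finset.erase_subset s S
  refine hS.2 (S.erase s) (Finset.erase_ssubset hs) ⟨hS.1.1, hS.1.2, hS.1.3,
    hS.1.4.mono_left hsub, hS.1.5.mono_left hsub, hS.1.6.mono_left hsub, ?_⟩
  intro x hx t ht hr
  obtain rfl := Finset.mem_singleton.1 hx
  refine hS.1.no_path x hx t ht ?_
  clear ht
  obtain ⟨-, hr⟩ := hr
  induction hr with
  | refl => exact ⟨Finset.disjoint_singleton_right.1 hS.1.disjoint_left, .refl⟩
  | @tail a b _ hb ih =>
    by_cases hbS : b ∈ S
    · by_cases hbs : b = s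
      · exact absurd (hbs ▸ hb.1) (hcon _ ih)
      · exact absurd (Finset.mem_erase.2 ⟨hbs, hbS⟩) hb.2
    · exact ih.adj hb.1 hbS

open Classical in
/-- The side of `S` in the split network. -/
noncomputable def separatorSide (G : Digraph (Fin n)) (v : Fin n) (S : Finset (Fin n)) :
    Finset (Fin (n * 2)) :=
  Finset.univ.filter fun u => Reaches G S v u.divNat ∨ u.modNat = 0 ∧ u.divNat ∈ S

theorem inNode_mem_separatorSide {u : Fin n} :
    inNode u ∈ separatorSide G v S ↔ Reaches G S v u ∨ u ∈ S := by
  simp [separatorSide]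

theorem outNode_mem_separatorSide {u : Fin n} :
    outNode u ∈ separatorSide G v S ↔ Reaches G S v u := by
  simp [separatorSide]

theorem isCutSide_separatorSide (hS : IsSeparator G W {v} T S) {A : Finset (Fin n)}
    (hA : ∀ a ∈ A, Reaches G S v a) : IsCutSide (IsEntry A) (IsEntry T) (separatorSide G v S) := by
  constructor
  · rintro u ⟨h0, hu⟩
    rw [eq_inNode h0, inNode_mem_separatorSide]
    exact .inl (hA _ hu)
  · rintro u ⟨h0, hu⟩
    rw [eq_inNode h0, inNode_mem_separatorSide]
    rintro (h | h)
    · exact hS.no_path v (by simp) _ hu h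
    · exact Finset.disjoint_left.1 hS.disjoint_right h hu

/-- An arc of G from a reachable vertex ends in a reachable vertex or in S, so its entry node is on
the side. Only the arcs inside vertices of S are cut, with capacity 1, or 0 on X. -/
theorem cutCap_separatorSide_le (hS : IsSeparator G W {v} T S) {X A : Finset (Fin n)}
    (hA : ∀ a ∈ A, Reaches G S v a) :
    cutCap (netCap G W p X A) (separatorSide G v S) ≤ (S \ X).card := by
  classical
  rw [cutCap_netCap]
  have h2 : (∑ u, ∑ w, if outNode u ∈ separatorSide G v S ∧ inNode w ∉ separatorSide G v S ∧
      G.Adj u w then p + 1 else 0) = 0 := by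
    refine Finset.sum_eq_zero fun u _ => Finset.sum_eq_zero fun w _ => if_neg ?_
    rw [outNode_mem_separatorSide, inNode_mem_separatorSide]
    rintro ⟨h1, h2, h3⟩
    rw [not_or] at h2
    exact h2.1 (h1.adj h3 h2.2)
  have h3 : (S \ X).card = ∑ u, if u ∈ S \ X then 1 else 0 := by
    rw [← Finset.card_filter]
    congr 1
    ext
    simp
  rw [h2, add_zero, h3]
  refine Finset.sum_le_sum fun u _ => ?_
  split
  case isFalse => simp
  case isTrue h =>
    rw [outNode_mem_separatorSide, inNode_mem_separatorSide] at h
    have hu : u ∈ S := h.1.resolve_left h.2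
    have hW : u ∉ W := Finset.disjoint_left.1 hS.disjoint_distinguished hu
    have hA' : u ∉ A := fun h' => (hA u h').notMem hu
    by_cases hX : u ∈ X <;> simp [vertexCap, hX, hu, hW, hA']

/-- The branching state `s` is compatible with `S` after `j` steps. -/
def BranchInv (G : Digraph (Fin n)) (W T : Finset (Fin n)) (p : ℕ) (v : Fin n)
    (S : Finset (Fin n)) (j : ℕ) (s : Finset (Fin n) × Finset (Fin n)) : Prop :=
  s.1 ⊆ S ∧ v ∈ s.2 ∧ (∀ a ∈ s.2, Reaches G S v a) ∧
    (s.1 = S ∨ ∀ C, IsCutSide (IsEntry s.2) (IsEntry T) C →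
      j ≤ 2 * s.1.card + cutCap (netCap G W p s.1 s.2) C)

/-- Let F be the furthest minimum cut. By submodularity the union of F with the side of S costs no
more than the side of S, and so yields a separator X ∪ D with at most |S| vertices whose reachable
set contains that of S. Importance forces equal reachable sets, and then minimality of S gives S = X
∪ D. A vertex crossing F that is not reachable from v in G \ S also crosses the union, so it belongs
to D and thus to S. -/
theorem mem_of_isCrossing (hS : IsImportantSeparator G W {v} T S) (hp : S.card ≤ p)
    {X A : Finset (Fin n)} (hX : X ⊆ S) (hvA : v ∈ A) (hA : ∀ a ∈ A, Reaches G S v a) {x : Fin n}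
    (hx : IsCrossing G W T p v (X, A) x) : x ∈ S ∨ Reaches G S v x := by
  classical
  by_contra! hcon
  have hsep := hS.1.1
  have hside := isCutSide_separatorSide hsep hA
  have hcut := cutCap_separatorSide_le (p := p) (X := X) hsep hA
  have hSX := Finset.card_sdiff_add_card_eq_card hX
  obtain ⟨hF1, hF2⟩ := furthestSide_spec (inNode v) hside
    (show cutCap (netCap G W p X A) (separatorSide G v S) < p + 1 by omega)
  obtain ⟨hx1, hx2, hx3⟩ := hx
  dsimp only [branchSide] at hx1 hx2 hx3
  generalize furthestSide (IsEntry A) (IsEntry T) (inNode v) (netCap G W p X A) (p + 1) = F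
    at hF1 hF2 hx1 hx2
  have hsub := cutCap_submodular (netCap G W p X A) (separatorSide G v S) F
  -- The intersection is again a cut, hence at least as expensive as F. In the submodular inequality
  -- this leaves the union at most as expensive as the side of S.
  have h1 := (hF2 (separatorSide G v S ∩ F)
    ⟨fun u hu => Finset.mem_inter.2 ⟨hside.1 u hu, hF1.1 u hu⟩,
      fun u hu h => hside.2 u hu (Finset.mem_inter.1 h).1⟩).1
  have hU : IsCutSide (IsEntry A) (IsEntry T) (separatorSide G v S ∪ F) :=
    ⟨fun u hu => Finset.mem_union_left _ (hside.1 u hu), fun u hu h =>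
      (Finset.mem_union.1 h).elim (hside.2 u hu) (hF1.2 u hu)⟩
  have hv : Reaches G S v v := hA v hvA
  have hsep' := isSeparator_of_cut (G := G) (p := p) hvA hU (by omega) (hsep.disjoint_distinguished.mono_left hX)
    (hsep.disjoint_right.mono_left hX) (fun h => hv.notMem (hX h)) hsep.nonempty_right
    (Finset.disjoint_singleton_left.1 hsep.disjoint)
  have hcard := card_crossing_le (G := G) (W := W) (p := p) X A (separatorSide G v S ∪ F)
  set D := Finset.univ.filter fun u => inNode u ∈ separatorSide G v S ∪ F ∧
    outNode u ∉ separatorSide G v S ∪ F ∧ u ∉ X with hD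
  have hle : (X ∪ D).card ≤ S.card := (Finset.card_union_le _ _).trans (by omega)
  have hreach : ∀ u, Reaches G S v u → u ∉ X ∪ D := by
    intro u hu h
    rcases Finset.mem_union.1 h with h | h
    · exact hu.notMem (hX h)
    · exact (Finset.mem_filter.1 h).2.2.1
        (Finset.mem_union_left _ (outNode_mem_separatorSide.2 hu))
  have hmono : reachSet G S {v} ⊆ reachSet G (X ∪ D) {v} := by
    intro u hu
    rw [mem_reachSet_singleton] at hu ⊢
    obtain ⟨h0, hu⟩ := hu
    induction hu with
    | refl => exact ⟨hreach v hv, .refl⟩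
    | tail h hb ih => exact ih.adj hb.1 (hreach _ ⟨h0, h.tail hb⟩)
  have heq : reachSet G S {v} = reachSet G (X ∪ D) {v} := by
    by_contra hne
    exact hS.2 ⟨X ∪ D, hsep', hle, hmono.ssubset_of_ne hne⟩
  have hSD : S ⊆ X ∪ D := by
    intro s hs
    by_contra hsD
    -- A vertex s of S outside X ∪ D would be reachable through u in G \ (X ∪ D), hence by equality
    -- of the reachable sets also in G \ S.
    obtain ⟨u, hu, hus⟩ := hS.1.exists_adj hs
    have h3 : s ∈ reachSet G (X ∪ D) {v} := by
      have : u ∈ reachSet G (X ∪ D) {v} := heq ▸ mem_reachSet_singleton.2 hu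
      exact mem_reachSet_singleton.2 ((mem_reachSet_singleton.1 this).adj hus hsD)
    rw [← heq] at h3
    exact (mem_reachSet_singleton.1 h3).notMem hs
  have hEq := Finset.eq_of_subset_of_card_le hSD hle
  refine hcon.1 (hEq ▸ Finset.mem_union_right _ (Finset.mem_filter.2 ⟨Finset.mem_univ _,
    Finset.mem_union_right _ hx1, ?_, hx3⟩))
  rw [Finset.mem_union, outNode_mem_separatorSide]
  tauto

/-- While X differs from S, the sum of 2|X| and the minimum cut must grow by one per step. If x goes
into X, the first term gains 2 and the cut loses at most 1. If x goes into A, the minimum cut itself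
grows, because F contains all minimum cuts and does not contain the exit node of x. -/
theorem BranchInv.step (hS : IsImportantSeparator G W {v} T S) (hp : S.card ≤ p) {j : ℕ}
    {s : Finset (Fin n) × Finset (Fin n)} (h : BranchInv G W T p v S j s) :
    ∃ bit : Bool, BranchInv G W T p v S (j + 1) (branchStep G W T p v (bit = true) s) := by
  classical
  obtain ⟨X, A⟩ := s
  obtain ⟨hX, hvA, hA, hj⟩ := h
  dsimp only at hX hvA hA hj
  have hsep := hS.1.1
  have hv : Reaches G S v v := hA v hvA
  have hside := isCutSide_separatorSide hsep hA
  have hcut := cutCap_separatorSide_le (p := p) (X := X) hsep hA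
  have hSX := Finset.card_sdiff_add_card_eq_card hX
  obtain ⟨hF1, hF2⟩ := furthestSide_spec (inNode v) hside
    (show cutCap (netCap G W p X A) (separatorSide G v S) < p + 1 by omega)
  have hFS := (hF2 _ hside).1
  by_cases hex : ∃ x, IsCrossing G W T p v (X, A) x
  · have hx := pick_spec (d := v) hex
    unfold branchStep
    generalize pick (IsCrossing G W T p v (X, A)) v = x at hx
    rcases mem_of_isCrossing hS hp hX hvA hA hx with hxS | hxR
    · refine ⟨true, ?_⟩
      simp only [hx, true_and, not_true, and_false, if_true, if_false]
      refine ⟨Finset.insert_subset hxS hX, hvA, hA, .inr fun C hC => ?_⟩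
      dsimp only at hC ⊢
      have hXS : X ≠ S := fun h => hx.2.2 (h ▸ hxS)
      have h1 := hj.resolve_left hXS C hC
      -- Deleting x changes only the arc inside x, from capacity 1 to 0.
      have h2 : cutCap (netCap G W p X A) C ≤
          cutCap (fun a b => netCap G W p (insert x X) A a b + unitArc (inNode x) (outNode x) a b)
            C := by
        refine cutCap_mono (fun a b => ?_) C
        have hxW : x ∉ W := Finset.disjoint_left.1 hsep.disjoint_distinguished hxS
        have hxA : x ∉ A := fun h => (hA x h).notMem hxS
        unfold netCap
        by_cases ha : a.modNat = 0
        · by_cases hb : b.modNat = 1 ∧ a.divNat = b.divNat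
          · by_cases hax : a.divNat = x
            · have e1 : a = inNode x := by rw [eq_inNode ha, hax]
              have e2 : b = outNode x := by
                have : finProdFinEquiv (b.divNat, b.modNat) = b :=
                  finProdFinEquiv.apply_symm_apply b
                rw [← this, hb.1, ← hb.2, hax, outNode]
              subst e1 e2
              have hxX : x ∉ X := hx.2.2
              simp [vertexCap, unitArc, hxW, hxA, hxX]
            · simp [vertexCap, ha, hb, Finset.mem_insert, hb.2 ▸ hax]
          · simp [ha, hb]
        · simp [ha]
      rw [cutCap_add, cutCap_unitArc] at h2
      rw [Finset.card_insert_of_notMem (show x ∉ X from hx.2.2)]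
      split at h2 <;> omega
    · refine ⟨false, ?_⟩
      simp only [hx, true_and, Bool.false_eq_true, not_false_eq_true, if_true, if_false]
      refine ⟨hX, Finset.mem_insert_of_mem hvA, ?_, hj.imp_right fun hj C hC => ?_⟩
      · simpa using ⟨hxR, hA⟩
      · dsimp only at hC ⊢
        have h1 := hj _ hF1
        by_contra hlt
        have hC' : IsCutSide (IsEntry A) (IsEntry T) C :=
          ⟨fun u hu => hC.1 u ⟨hu.1, Finset.mem_insert_of_mem hu.2⟩, hC.2⟩
        have h2 : cutCap (netCap G W p X A) C ≤ cutCap (netCap G W p X (insert x A)) C := by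
          refine cutCap_mono (fun a b => ?_) C
          have h3 : vertexCap W p X A a.divNat ≤ vertexCap W p X (insert x A) a.divNat := by
            unfold vertexCap
            by_cases h1 : a.divNat ∈ X <;> by_cases h2 : a.divNat ∈ W ∨ a.divNat ∈ A
            · simp [h1]
            · simp [h1]
            · rw [if_neg h1, if_pos h2, if_neg h1,
                if_pos (h2.imp_right fun h => Finset.mem_insert_of_mem h)]
            · rw [if_neg h1, if_neg h2, if_neg h1]
              split <;> omega
          unfold netCap
          split
          · split
            · exact h3
            · exact le_rfl
          · exact le_rfl
        -- If the minimum did not grow, C would be a minimum cut for the old A, hence inside F. It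
        -- would then cut the vertex x, whose cost is now p + 1.
        have h3 := (hF2 C hC').2 (by omega)
        have h4 := vertexCap_le_cutCap (G := G) (W := W) (p := p) (X := X) (A := insert x A)
          (hC.1 (inNode x) ⟨by simp, by simp⟩) (fun h => hx.2.1 (h3 h))
        have h5 : vertexCap W p X (insert x A) x = p + 1 := by
          have hxX : x ∉ X := hx.2.2
          simp [vertexCap, hxX]
        omega
  · refine ⟨true, ?_⟩
    have hst : branchStep G W T p v (true = true) (X, A) = (X, A) := by
      unfold branchStep
      simp only [not_exists] at hex
      simp [hex]
    rw [hst]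
    -- Without a crossing vertex outside X, the set X alone separates v from T, and minimality of S
    -- gives X = S.
    refine ⟨hX, hvA, hA, .inl ?_⟩
    have hsep' := isSeparator_of_cut (G := G) (p := p) hvA hF1 (by omega)
      (hsep.disjoint_distinguished.mono_left hX) (hsep.disjoint_right.mono_left hX)
      (fun h => hv.notMem (hX h)) hsep.nonempty_right
      (Finset.disjoint_singleton_left.1 hsep.disjoint)
    have hnone : (Finset.univ.filter fun u =>
        inNode u ∈ furthestSide (IsEntry A) (IsEntry T) (inNode v) (netCap G W p X A) (p + 1) ∧
        outNode u ∉ furthestSide (IsEntry A) (IsEntry T) (inNode v) (netCap G W p X A) (p + 1) ∧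
        u ∉ X) = ∅ :=
      Finset.filter_false_of_mem fun u _ h => hex ⟨u, h⟩
    rw [hnone, Finset.union_empty] at hsep'
    by_contra hne
    exact hS.1.2 X (hX.ssubset_of_ne hne) hsep'

/-- Some number below `2 ^ k` has prescribed binary digits. -/
theorem exists_testBit (f : ℕ → Bool) (k : ℕ) : ∃ b < 2 ^ k, ∀ j < k, b.testBit j = f j := by
  refine ⟨Nat.ofBits fun i : Fin k => f i, Nat.ofBits_lt_two_pow _, fun j hj => ?_⟩
  rw [Nat.testBit_ofBits_lt _ _ hj]

/-- Every important separator of size at most `p` is found. -/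
theorem exists_branchState_eq (hS : IsImportantSeparator G W {v} T S) (hp : S.card ≤ p) :
    ∃ b < 2 ^ (2 * p + 1), (branchState G W T p v b (2 * p + 1)).1 = S := by
  classical
  have hv : Reaches G S v v := ⟨Finset.disjoint_singleton_right.1 hS.1.1.disjoint_left, .refl⟩
  have h0 : BranchInv G W T p v S 0 (∅, {v}) :=
    ⟨by simp, by simp, by simpa using hv, .inr fun _ _ => Nat.zero_le _⟩
  -- The state after k steps depends only on the first k digits of b, so the right decisions can be
  -- fixed one at a time.
  have key : ∀ k, ∃ f : ℕ → Bool, ∀ b : ℕ, (∀ j < k, b.testBit j = f j) →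
      BranchInv G W T p v S k (branchState G W T p v b k) := by
    intro k
    induction k with
    | zero => exact ⟨fun _ => true, fun _ _ => h0⟩
    | succ k ih =>
      obtain ⟨f, hf⟩ := ih
      obtain ⟨b, -, hb⟩ := exists_testBit f k
      obtain ⟨bit, hbit⟩ := (hf b hb).step hS hp
      refine ⟨fun j => if j < k then f j else bit, fun b' hb' => ?_⟩
      have hagree : ∀ l ≤ k, branchState G W T p v b' l = branchState G W T p v b l := by
        intro l
        induction l with
        | zero => intro _; rfl
        | succ l ih =>
          intro hl
          have e : b'.testBit l = f l := (hb' l (by omega)).trans (if_pos (by omega))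
          rw [branchState, branchState, ih (by omega), e, hb l (by omega)]
      have e : b'.testBit k = bit := (hb' k (by omega)).trans (if_neg (by omega))
      rw [branchState, hagree k le_rfl, e]
      exact hbit
  obtain ⟨f, hf⟩ := key (2 * p + 1)
  obtain ⟨b, hb, hbf⟩ := exists_testBit f (2 * p + 1)
  refine ⟨b, hb, ?_⟩
  obtain ⟨hX, -, hA, h⟩ := hf b hbf
  by_contra hne
  -- Otherwise 2p + 1 ≤ 2|X| + |S \ X| ≤ 2|S| ≤ 2p.
  have h1 := h.resolve_left hne _ (isCutSide_separatorSide hS.1.1 hA)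
  have h2 := cutCap_separatorSide_le (p := p)
    (X := (branchState G W T p v b (2 * p + 1)).1) hS.1.1 hA
  have h3 := Finset.card_sdiff_add_card_eq_card hX
  omega

end Branching

/-! ## Colourings that separate small sets -/

section Hashing

variable {n : ℕ}

/-- The weight of the earlier elements that have colour `a`. -/
def colorCost {q : ℕ} (w : Fin n → Fin n → ℕ) (h : Fin n → Fin (q + 1)) (x : Fin n)
    (a : Fin (q + 1)) : ℕ :=
  ∑ y, if y < x ∧ h y = a then w x y else 0

/-- The greedy colouring with `q + 1` colours after `j` steps. -/
noncomputable def greedyColor (q : ℕ) (w : Fin n → Fin n → ℕ) : ℕ → Fin n → Fin (q + 1)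
  | 0 => fun _ => 0
  | j + 1 => fun x =>
    if x.val = j then
      pick (fun a => ∀ b, colorCost w (greedyColor q w j) x a ≤ colorCost w (greedyColor q w j) x b) 0
    else greedyColor q w j x

/-- The weights double on every pair with equal colours. -/
noncomputable def pairWeight (n q : ℕ) : ℕ → Fin n → Fin n → ℕ
  | 0 => fun _ _ => 1
  | l + 1 => fun x y => pairWeight n q l x y +
    if x ≠ y ∧ greedyColor q (pairWeight n q l) n x = greedyColor q (pairWeight n q l) n y then
      pairWeight n q l x y else 0

/-- The `l`-th colouring of the family. -/
noncomputable def hashColor (n q l : ℕ) : Fin n → Fin (q + 1) :=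
  greedyColor q (pairWeight n q l) n

theorem greedyColor_succ {q : ℕ} (w : Fin n → Fin n → ℕ) (j : ℕ) (x : Fin n) :
    greedyColor q w (j + 1) x = if x.val = j then
      pick (fun a => ∀ b, colorCost w (greedyColor q w j) x a ≤ colorCost w (greedyColor q w j) x b) 0
    else greedyColor q w j x := rfl

theorem pairWeight_succ (q l : ℕ) (x y : Fin n) :
    pairWeight n q (l + 1) x y = pairWeight n q l x y +
      if x ≠ y ∧ hashColor n q l x = hashColor n q l y then pairWeight n q l x y else 0 := rfl

theorem greedyColor_eq {q : ℕ} (w : Fin n → Fin n → ℕ) {x : Fin n} {j k : ℕ} (hx : x.val < j)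
    (hj : j ≤ k) : greedyColor q w k x = greedyColor q w j x := by
  induction hj with
  | refl => rfl
  | step h ih =>
    have h' : j ≤ _ := h
    rw [greedyColor_succ, if_neg (by omega), ih]

/-- The colour of x minimises the weight towards earlier vertices of that colour, and a minimum over
q + 1 colours is at most the average. Summed over all colours, these weights give the whole weight
of x towards earlier vertices. -/
theorem sum_same_color_le (q : ℕ) (w : Fin n → Fin n → ℕ) (x : Fin n) :
    (q + 1) * (∑ y, if y < x ∧ greedyColor q w n x = greedyColor q w n y then w x y else 0) ≤
      ∑ y, if y < x then w x y else 0 := by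
  -- Only vertices before x enter the cost, and their colours are final when x is coloured.
  have hcost : ∀ a, colorCost w (greedyColor q w x) x a = colorCost w (greedyColor q w n) x a := by
    intro a
    refine Finset.sum_congr rfl fun y _ => ?_
    by_cases h : y < x
    · rw [greedyColor_eq w (j := x) (k := n) h x.2.le]
    · simp [h]
  have hmin : ∀ b, colorCost w (greedyColor q w n) x (greedyColor q w n x) ≤
      colorCost w (greedyColor q w n) x b := by
    have hex : ∃ a, ∀ b, colorCost w (greedyColor q w x) x a ≤ colorCost w (greedyColor q w x) x b :=
      Finite.exists_min _
    have := pick_spec (d := (0 : Fin (q + 1))) hex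
    rw [greedyColor_eq w (j := x + 1) (k := n) (x := x) (by omega) (by omega),
      greedyColor_succ, if_pos rfl]
    simpa only [hcost] using this
  calc _ = ∑ b : Fin (q + 1), colorCost w (greedyColor q w n) x (greedyColor q w n x) := by
        simp [colorCost, eq_comm]
    _ ≤ ∑ b, colorCost w (greedyColor q w n) x b := Finset.sum_le_sum fun b _ => hmin b
    _ = _ := by
        unfold colorCost
        rw [Finset.sum_comm]
        refine Finset.sum_congr rfl fun y _ => ?_
        by_cases h : y < x <;> simp [h]

theorem pairWeight_symm (q l : ℕ) (x y : Fin n) : pairWeight n q l x y = pairWeight n q l y x := by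
  induction l with
  | zero => rfl
  | succ l ih =>
    rw [pairWeight_succ, pairWeight_succ, ih]
    congr 1
    refine if_congr ?_ rfl rfl
    rw [ne_comm, eq_comm (a := hashColor n q l x)]

theorem pairWeight_self (q l : ℕ) (x : Fin n) : pairWeight n q l x x = 1 := by
  induction l with
  | zero => rfl
  | succ l ih => simp [pairWeight, ih]

theorem pairWeight_eq (q l : ℕ) {x y : Fin n} (h : x ≠ y) :
    pairWeight n q l x y =
      2 ^ ((Finset.range l).filter fun i => hashColor n q i x = hashColor n q i y).card := by
  induction l with
  | zero => rfl
  | succ l ih =>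
    rw [pairWeight_succ, ih, Finset.range_add_one, Finset.filter_insert]
    by_cases hc : hashColor n q l x = hashColor n q l y
    · rw [if_pos ⟨h, hc⟩, if_pos hc, Finset.card_insert_of_notMem (by simp), pow_succ, mul_two]
    · rw [if_neg (fun h => hc h.2), if_neg hc, add_zero]

/-- The total weight of the pairs. -/
noncomputable def totalWeight (n q l : ℕ) : ℕ :=
  ∑ x : Fin n, ∑ y : Fin n, if y < x then pairWeight n q l x y else 0

/-- Only the colliding pairs double, and they carry at most a 1/(q+1) fraction of the weight, for
each x separately. -/
theorem totalWeight_succ (n q l : ℕ) :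
    (q + 1) * totalWeight n q (l + 1) ≤ (q + 2) * totalWeight n q l := by
  unfold totalWeight
  rw [Finset.mul_sum, Finset.mul_sum]
  refine Finset.sum_le_sum fun x _ => ?_
  have h := sum_same_color_le q (pairWeight n q l) x
  have h2 : (∑ y, if y < x then pairWeight n q (l + 1) x y else 0) =
      (∑ y, if y < x then pairWeight n q l x y else 0) +
      ∑ y, if y < x ∧ greedyColor q (pairWeight n q l) n x = greedyColor q (pairWeight n q l) n y
        then pairWeight n q l x y else 0 := by
    rw [← Finset.sum_add_distrib]
    refine Finset.sum_congr rfl fun y _ => ?_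
    by_cases hy : y < x
    · simp [hy, pairWeight, hy.ne']
    · simp [hy]
  rw [h2]
  linarith

theorem totalWeight_le (n q l : ℕ) :
    (q + 1) ^ l * totalWeight n q l ≤ (q + 2) ^ l * (n * n) := by
  induction l with
  | zero =>
    rw [pow_zero, pow_zero, one_mul, one_mul]
    calc _ ≤ ∑ x : Fin n, ∑ y : Fin n, 1 :=
          Finset.sum_le_sum fun x _ => Finset.sum_le_sum fun y _ => by
            split <;> simp [pairWeight]
      _ = n * n := by simp
  | succ l ih =>
    calc _ = (q + 1) ^ l * ((q + 1) * totalWeight n q (l + 1)) := by ring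
      _ ≤ (q + 1) ^ l * ((q + 2) * totalWeight n q l) :=
          Nat.mul_le_mul_left _ (totalWeight_succ n q l)
      _ = (q + 2) * ((q + 1) ^ l * totalWeight n q l) := by ring
      _ ≤ (q + 2) * ((q + 2) ^ l * (n * n)) := Nat.mul_le_mul_left _ ih
      _ = _ := by ring

/-- By 1 + t ≤ exp t, the ratio ((q+2)/(q+1))^l is at most exp(l/(q+1)) ≤ exp(s/2), and exp 1 ≤ 4.
-/
theorem succ_pow_le {q l s : ℕ} (h : 2 * l ≤ (q + 1) * s) :
    (q + 2) ^ l ≤ 2 ^ s * (q + 1) ^ l := by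
  have hq : (0 : ℝ) < q + 1 := by positivity
  have h1 : ((q : ℝ) + 2) / (q + 1) ≤ Real.exp (1 / (q + 1)) := by
    have := Real.add_one_le_exp (1 / ((q : ℝ) + 1))
    refine le_trans (le_of_eq ?_) this
    field_simp
    ring
  have h2 : Real.exp 1 ≤ 2 ^ 2 := by
    have := Real.exp_one_lt_d9
    linarith
  have h3 : ((q : ℝ) + 2) ^ l ≤ 2 ^ s * (q + 1) ^ l := by
    rw [← div_le_iff₀ (by positivity), ← div_pow]
    -- Squaring produces the exponent 2l, to which the hypothesis applies.
    refine abs_le_of_sq_le_sq' ?_ (by positivity) |>.2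
    calc ((((q : ℝ) + 2) / (q + 1)) ^ l) ^ 2
        = (((q : ℝ) + 2) / (q + 1)) ^ (2 * l) := by rw [← pow_mul, mul_comm]
      _ ≤ Real.exp (1 / (q + 1)) ^ (2 * l) := by gcongr
      _ ≤ Real.exp (1 / (q + 1)) ^ ((q + 1) * s) :=
          pow_le_pow_right₀ (Real.one_le_exp (by positivity)) h
      _ = Real.exp 1 ^ s := by
          rw [pow_mul, ← Real.exp_nat_mul]
          congr 2
          push_cast
          field_simp
      _ ≤ (2 ^ 2) ^ s := by gcongr
      _ = (2 ^ s) ^ 2 := by rw [← pow_mul, ← pow_mul, mul_comm]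
  exact_mod_cast h3

/-- The weight of one pair is at most the total weight, which counts each unordered pair once;
diagonal entries stay equal to 1. The bound limits the number of collisions and also keeps the
weights polynomial in n for the algorithm. -/
theorem pairWeight_le {q l s : ℕ} (h : 2 * l ≤ (q + 1) * s) (x y : Fin n) :
    pairWeight n q l x y ≤ 2 ^ s * (n * n) := by
  have htot : totalWeight n q l ≤ 2 ^ s * (n * n) := by
    refine Nat.le_of_mul_le_mul_left (c := (q + 1) ^ l) ?_ (Nat.pow_pos (Nat.succ_pos q))
    calc _ ≤ (q + 2) ^ l * (n * n) := totalWeight_le n q l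
      _ ≤ 2 ^ s * (q + 1) ^ l * (n * n) := Nat.mul_le_mul_right _ (succ_pow_le h)
      _ = _ := by ring
  have key : ∀ x y : Fin n, y < x → pairWeight n q l x y ≤ totalWeight n q l := by
    intro x y hxy
    unfold totalWeight
    refine le_trans ?_ (Finset.single_le_sum
      (f := fun x => ∑ y, if y < x then pairWeight n q l x y else 0)
      (fun _ _ => Nat.zero_le _) (Finset.mem_univ x))
    refine le_trans ?_ (Finset.single_le_sum
      (f := fun y => if y < x then pairWeight n q l x y else 0)
      (fun _ _ => Nat.zero_le _) (Finset.mem_univ y))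
    simp [hxy]
  rcases lt_trichotomy x y with h' | rfl | h'
  · rw [pairWeight_symm]
    exact (key y x h').trans htot
  · rw [pairWeight_self]
    have := x.pos
    exact Nat.succ_le_of_lt (Nat.mul_pos (Nat.two_pow_pos s) (Nat.mul_pos this this))
  · exact (key x y h').trans htot

/-- Some set of colours in the family contains the colours of `S` and avoids the colours of `K`. -/
theorem exists_separating_color {r s : ℕ} (hr : 0 < r) (hs0 : 0 < s) (hs : n * n < 2 ^ s)
    {S K : Finset (Fin n)} (hSK : Disjoint S K) (hcard : S.card * K.card ≤ r) :
    ∃ l < 2 * r * s, ∃ d < 2 ^ (4 * r - 1 + 1),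
      (∀ x ∈ S, d.testBit (hashColor n (4 * r - 1) l x) = true) ∧
      ∀ y ∈ K, d.testBit (hashColor n (4 * r - 1) l y) = false := by
  set q := 4 * r - 1 with hq
  -- With q + 1 = 4r and l = 2rs the weight, 2 to the number of collisions, is at most 2^s·n² <
  -- 2^(2s).
  have hcoll : ∀ x ∈ S, ∀ y ∈ K,
      ((Finset.range (2 * r * s)).filter fun i => hashColor n q i x = hashColor n q i y).card
        < 2 * s := by
    intro x hx y hy
    have hne : x ≠ y := fun h => Finset.disjoint_left.1 hSK hx (h ▸ hy)
    have h1 := pairWeight_le (q := q) (l := 2 * r * s) (s := s)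
      (by rw [show q + 1 = 4 * r by omega]; exact le_of_eq (by ring)) x y
    rw [pairWeight_eq _ _ hne] at h1
    refine (Nat.pow_lt_pow_iff_right (a := 2) (by norm_num)).1 (h1.trans_lt ?_)
    rw [two_mul, pow_add]
    exact Nat.mul_lt_mul_of_pos_left hs (by positivity)
  obtain ⟨l, hl, hsep⟩ : ∃ l < 2 * r * s, ∀ x ∈ S, ∀ y ∈ K,
      hashColor n q l x ≠ hashColor n q l y := by
    -- Double counting: a collision in each of the 2rs rounds would need at least 2rs collisions,
    -- but at most r pairs with at most 2s − 1 collisions each give at most r(2s − 1).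
    by_contra! hcon
    have h1 : 2 * r * s ≤ ∑ z ∈ S ×ˢ K,
        ((Finset.range (2 * r * s)).filter fun i =>
          hashColor n q i z.1 = hashColor n q i z.2).card := by
      simp_rw [Finset.card_filter]
      rw [Finset.sum_comm]
      calc 2 * r * s = ∑ i ∈ Finset.range (2 * r * s), 1 := by simp
        _ ≤ _ := Finset.sum_le_sum fun i hi => by
            obtain ⟨x, hx, y, hy, h⟩ := hcon i (Finset.mem_range.1 hi)
            refine le_trans ?_ (Finset.single_le_sum
              (f := fun z : Fin n × Fin n => if hashColor n q i z.1 = hashColor n q i z.2 then 1 else 0)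
              (fun _ _ => Nat.zero_le _) (Finset.mk_mem_product hx hy))
            simp [h]
    have h2 := h1.trans (Finset.sum_le_card_nsmul _ _ (2 * s - 1) fun z hz => by
      have := hcoll z.1 (Finset.mem_product.1 hz).1 z.2 (Finset.mem_product.1 hz).2
      omega)
    rw [Finset.card_product, smul_eq_mul] at h2
    have h3 := h2.trans (Nat.mul_le_mul_right _ hcard)
    have h4 : r * (2 * s - 1) + r = 2 * r * s := by
      rw [← Nat.mul_succ, Nat.succ_eq_add_one, Nat.sub_add_cancel (by omega)]
      ring
    omega
  classical
  -- The binary digits of d mark the colours that occur on S.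
  obtain ⟨d, hd, hbit⟩ := exists_testBit
    (fun a => decide (∃ x ∈ S, (hashColor n q l x).val = a)) (q + 1)
  refine ⟨l, hl, d, hd, fun x hx => ?_, fun y hy => ?_⟩
  · rw [hbit _ (hashColor n q l x).2]
    exact decide_eq_true ⟨x, hx, rfl⟩
  · rw [hbit _ (hashColor n q l y).2]
    refine decide_eq_false ?_
    rintro ⟨x, hx, h⟩
    exact hsep x hx y hy (Fin.ext h)

end Hashing

/-! ## The sample -/

section Sample

variable {n : ℕ}

/-- A bound on the number of pairs of vertices that a colouring has to separate. -/
def numPairs (p : ℕ) : ℕ := p * (p * (2 ^ (2 * p + 1) * p)) + 1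

/-- Logarithmic length of the family of colourings. -/
def numRounds (n : ℕ) : ℕ := 2 * Nat.log 2 n + 3

/-- The number of sets of colours. -/
def numColorSets (p : ℕ) : ℕ := 2 ^ (4 * numPairs p)

/-- The size of the sample. -/
def sampleSize (n p : ℕ) : ℕ := 2 * numPairs p * numRounds n * numColorSets p

/-- The vertex set that is selected by the `e`-th colouring and set of colours. -/
def Selected (n p e : ℕ) (v : Fin n) : Prop :=
  (e % numColorSets p).testBit (hashColor n (4 * numPairs p - 1) (e / numColorSets p) v) = true

variable (G : Digraph (Fin n)) (W T : Finset (Fin n)) (p : ℕ)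

/-- The `b`-th candidate for a small separator between `v` and the terminals. -/
noncomputable def candidate (v : Fin n) (b : ℕ) : Finset (Fin n) :=
  (branchState G W T p v b (2 * p + 1)).1

open Classical in
/-- The vertices that are separated from the terminals by selected vertices. -/
noncomputable def sampleSet (e : ℕ) : Finset (Fin n) :=
  Finset.univ.filter fun v => ∃ b : Fin (2 ^ (2 * p + 1)),
    IsSeparator G W {v} T (candidate G W T p v b) ∧ (candidate G W T p v b).card ≤ p ∧
      ∀ x, x ∈ candidate G W T p v b → Selected n p e x

variable {G W T p}

theorem sq_lt_two_pow_numRounds (n : ℕ) : n * n < 2 ^ numRounds n := by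
  have h := Nat.lt_pow_succ_log_self (b := 2) (by norm_num) n
  calc n * n < 2 ^ (Nat.log 2 n).succ * 2 ^ (Nat.log 2 n).succ := Nat.mul_self_lt_mul_self h
    _ = 2 ^ (2 * Nat.log 2 n + 2) := by rw [← pow_add]; congr 1; omega
    _ ≤ _ := Nat.pow_le_pow_right (by omega) (by unfold numRounds; omega)

/-- The selected sets separate small disjoint sets of vertices. -/
theorem exists_selected {S K : Finset (Fin n)} (hSK : Disjoint S K)
    (hcard : S.card * K.card ≤ numPairs p) :
    ∃ e < sampleSize n p, (∀ x ∈ S, Selected n p e x) ∧ ∀ y ∈ K, ¬ Selected n p e y := by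
  have hr : 0 < numPairs p := by unfold numPairs; omega
  obtain ⟨l, hl, d, hd, h1, h2⟩ := exists_separating_color hr
    (show 0 < numRounds n by unfold numRounds; omega) (sq_lt_two_pow_numRounds n) hSK hcard
  rw [show 4 * numPairs p - 1 + 1 = 4 * numPairs p by omega] at hd
  change d < numColorSets p at hd
  have hmod : (l * numColorSets p + d) % numColorSets p = d := by
    rw [mul_comm, Nat.mul_add_mod, Nat.mod_eq_of_lt hd]
  have hdiv : (l * numColorSets p + d) / numColorSets p = l := by
    rw [mul_comm, Nat.mul_add_div (show numColorSets p > 0 from Nat.two_pow_pos _), Nat.div_eq_of_lt hd, add_zero]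
  refine ⟨l * numColorSets p + d, ?_, ?_, ?_⟩
  · calc l * numColorSets p + d < (l + 1) * numColorSets p := by
          rw [add_one_mul]; exact Nat.add_lt_add_left hd _
      _ ≤ _ := Nat.mul_le_mul_right _ hl
  · intro x hx
    rw [Selected, hmod, hdiv]
    exact h1 x hx
  · intro y hy
    rw [Selected, hmod, hdiv, h2 y hy]
    simp

theorem sampleSet_disjoint (e : ℕ) : Disjoint (sampleSet G W T p e) T :=
  Finset.disjoint_left.2 fun v hv hT => by
    classical
    obtain ⟨b, hb, -⟩ := (Finset.mem_filter.1 hv).2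
    exact Finset.disjoint_singleton_left.1 hb.disjoint hT

theorem IsSeparator.mono {v : Fin n} {X S : Finset (Fin n)} (hX : IsSeparator G W {v} T X)
    (hXS : X ⊆ S) (hv : v ∉ S) (hT : Disjoint S T) (hW : Disjoint S W) :
    IsSeparator G W {v} T S :=
  ⟨hX.1, hX.2, hX.3, by simpa using hv, hT, hW, fun x hx t ht h => hX.no_path x hx t ht
    ⟨fun h' => h.1 (hXS h'), Relation.ReflTransGen.mono (fun _ _ h => ⟨h.1, fun h' => h.2 (hXS h')⟩) _ _ h.2⟩⟩

/-- A selection containing S and avoiding K turns every fully selected small candidate of a vertex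
of S into a subset of S. Thinness excludes such candidates that separate, while the important
separators inside S survive as candidates of the vertices of Y. -/
theorem exists_sampleSet (hTW : T ⊆ W) {S Y : Finset (Fin n)} (hSW : Disjoint S W)
    (hp : S.card ≤ p) (hthin : IsThin G W T S)
    (hY : ∀ v ∈ Y, ∃ S', S' ⊆ S ∧ IsImportantSeparator G W {v} T S') :
    ∃ e < sampleSize n p, Disjoint S (sampleSet G W T p e) ∧ Y ⊆ sampleSet G W T p e := by
  classical
  -- Only candidates of vertices of S enter K, which makes its size independent of n.
  set K := (S.biUnion fun v => (Finset.range (2 ^ (2 * p + 1))).biUnion fun b =>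
    if (candidate G W T p v b).card ≤ p then candidate G W T p v b else ∅) \ S with hK
  have hKcard : K.card ≤ p * (2 ^ (2 * p + 1) * p) := by
    refine (Finset.card_le_card Finset.sdiff_subset).trans ?_
    refine (Finset.card_biUnion_le_card_mul _ _ (2 ^ (2 * p + 1) * p) fun v _ => ?_).trans
      (Nat.mul_le_mul_right _ hp)
    refine (Finset.card_biUnion_le_card_mul _ _ p fun b _ => ?_).trans (by simp)
    split
    case isTrue h => exact h
    case isFalse => simp
  obtain ⟨e, he, h1, h2⟩ := exists_selected (p := p) (S := S) (K := K) Finset.disjoint_sdiff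
    ((Nat.mul_le_mul hp hKcard).trans (Nat.le_succ _))
  refine ⟨e, he, Finset.disjoint_left.2 fun v hv hvZ => ?_, fun v hv => ?_⟩
  · obtain ⟨b, hb, hbp, hsel⟩ := (Finset.mem_filter.1 hvZ).2
    have hsub : candidate G W T p v b ⊆ S := by
      intro x hx
      by_contra hxS
      refine h2 x (Finset.mem_sdiff.2 ⟨Finset.mem_biUnion.2 ⟨v, hv, Finset.mem_biUnion.2
        ⟨b, Finset.mem_range.2 b.2, ?_⟩⟩, hxS⟩) (hsel x hx)
      rwa [if_pos hbp]
    have hvb : v ∉ candidate G W T p v b := Finset.disjoint_singleton_right.1 hb.disjoint_left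
    have her := Finset.erase_subset v S
    -- A separator of v does not contain v, so the candidate lies in S \ {v}; enlarging it to S \
    -- {v} keeps it a separator because S avoids W and hence T.
    exact hthin v hv (hb.mono (fun x hx => Finset.mem_erase.2 ⟨fun h => hvb (h ▸ hx), hsub hx⟩)
      (Finset.notMem_erase v S) ((hSW.mono_right hTW).mono_left her) (hSW.mono_left her))
  · obtain ⟨S', hS', himp⟩ := hY v hv
    have hS'p := (Finset.card_le_card hS').trans hp
    obtain ⟨b, hb, hbS⟩ := exists_branchState_eq himp hS'p
    refine Finset.mem_filter.2 ⟨Finset.mem_univ _, ⟨b, hb⟩, ?_⟩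
    have : candidate G W T p v b = S' := hbS
    rw [this]
    exact ⟨himp.1.1, hS'p, fun x hx => h1 x (hS' hx)⟩

/-- A reformulation of separation by reachability in a finite network. -/
theorem isSeparator_iff {v : Fin n} {X : Finset (Fin n)} :
    open Classical in
    IsSeparator G W {v} T X ↔ (∃ t, t ∈ T) ∧ v ∉ T ∧ v ∉ X ∧ (∀ x, x ∈ X → x ∉ T) ∧
      (∀ x, x ∈ X → x ∉ W) ∧
      ¬ CanReach (fun a b => if G.Adj a b ∧ b ∉ X then 1 else 0) (fun t => t ∈ T) v := by
  classical
  rw [canReach_iff]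
  constructor
  · intro h
    refine ⟨h.nonempty_right, Finset.disjoint_singleton_left.1 h.disjoint,
      Finset.disjoint_singleton_right.1 h.disjoint_left,
      fun x hx => Finset.disjoint_left.1 h.disjoint_right hx,
      fun x hx => Finset.disjoint_left.1 h.disjoint_distinguished hx, ?_⟩
    rintro ⟨t, ht, hr⟩
    refine h.no_path v (by simp) t ht
      ⟨Finset.disjoint_singleton_right.1 h.disjoint_left, Relation.ReflTransGen.mono (fun a b hab => ?_) _ _ hr⟩
    by_contra hcon
    simp [hcon] at hab
  · rintro ⟨h1, h2, h3, h4, h5, h6⟩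
    refine ⟨by simp, h1, by simpa using h2, by simpa using h3, Finset.disjoint_left.2 h4,
      Finset.disjoint_left.2 h5, fun y hy t ht hr => h6 ⟨t, ht, ?_⟩⟩
    obtain rfl := Finset.mem_singleton.1 hy
    exact Relation.ReflTransGen.mono (fun a b hab => by simp [hab.1, hab.2]) _ _ hr.2

end Sample

/-! ## Computability of the sample -/

theorem Val.le_top_tab {n : ℕ} (f : Fin n → Val) (j : Fin n) : (f j).top ≤ (tab f).top :=
  top_mem_ofList ((List.mem_ofFn' _ _).2 ⟨j, rfl⟩)

theorem Val.le_top_matTab {n : ℕ} (f : Fin n → Fin n → ℕ) (a b : Fin n) :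
    f a b ≤ (matTab f).top :=
  (le_top_tab (fun b => .atom (f a b)) b).trans (le_top_tab (fun a => .funTab (f a)) a)

theorem Val.top_matTab_le {n B : ℕ} {f : Fin n → Fin n → ℕ} (h : ∀ a b, f a b ≤ B) :
    (matTab f).top ≤ B :=
  top_tab_le fun a => top_tab_le (f := fun b => .atom (f a b)) fun b => h a b

/-- Each step adds at most one unit to an entry. Such bounds keep the tables of residual capacities
polynomial, as iteration in `PolyComp` requires. -/
theorem pushPath_le {M : ℕ} (c : Fin M → Fin M → ℕ) (snk : Fin M → Prop) (u : Fin M) (j : ℕ)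
    (a b : Fin M) : (pushPath c snk u j).1 a b ≤ c a b + j := by
  induction j with
  | zero => exact le_rfl
  | succ j ih =>
    rw [pushPath_succ]
    unfold pushStep
    split
    · omega
    · dsimp only
      have : ∀ d e : Fin M, unitArc d e a b ≤ 1 := fun d e => by unfold unitArc; split <;> simp
      have := this (closerNode c snk (pushPath c snk u j).2) (pushPath c snk u j).2
      omega

theorem residual_le {M : ℕ} (src snk : Fin M → Prop) (d : Fin M) (c : Fin M → Fin M → ℕ) (k : ℕ)
    (a b : Fin M) : residual src snk d c k a b ≤ c a b + k * M := by
  induction k with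
  | zero => simp [residual]
  | succ k ih =>
    rw [residual_succ, augment, add_mul, one_mul]
    split
    · refine (pushPath_le _ _ _ _ _ _).trans ?_
      omega
    · omega

namespace PolyComp

variable {ι : Type} {m : ι → ℕ} {x : ι → Val}

/-! ### Computability of maximum flows and furthest minimum cuts. -/

section Flow

variable {M : ι → ℕ} {c : ∀ i, Fin (M i) → Fin (M i) → ℕ} {src snk : ∀ i, Fin (M i) → Prop}
  {k : ι → ℕ}

theorem reachIn (hM : PolyComp m x (fun i => .atom (M i)))
    (hc : PolyComp m x (fun i => .matTab (c i))) (hsnk : PolyComp m x (fun i => .setTab (snk i)))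
    (hk : PolyComp m x (fun i => .atom (k i))) :
    PolyComp m x (fun i => .setTab (ReachIn (c i) (snk i) (k i))) := by
  refine rec' (s := fun i j => .setTab (ReachIn (c i) (snk i) j)) hk hsnk PolyBdd.setTab ?_
  intro u hl _ _ h
  have hM' := hl hM
  refine setTab hM' (or (get_set (h.lift_fin hM') hM'.var_fin) (exists_fin (hM'.lift_fin hM') ?_))
  have hM2 := hM'.lift_fin hM'
  exact and (lt (zero hM2.var_fin.env_bdd) (get_mat (((hl hc).lift_fin hM').lift_fin hM2)
    (hM'.var_fin.lift_fin hM2) hM2.var_fin)) (get_set ((h.lift_fin hM').lift_fin hM2) hM2.var_fin)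

theorem canReach (hM : PolyComp m x (fun i => .atom (M i)))
    (hc : PolyComp m x (fun i => .matTab (c i))) (hsnk : PolyComp m x (fun i => .setTab (snk i))) :
    PolyComp m x (fun i => .setTab (CanReach (c i) (snk i))) :=
  reachIn hM hc hsnk hM

theorem sinkDist (hM : PolyComp m x (fun i => .atom (M i)))
    (hc : PolyComp m x (fun i => .matTab (c i))) (hsnk : PolyComp m x (fun i => .setTab (snk i))) :
    PolyComp m x (fun i => .funTab (DetSampling.sinkDist (c i) (snk i))) := by
  have hM2 := hM.lift_fin hM
  refine funTab hM (sum_fin hM2 (ite_atom ?_ (zero hM2.var_fin.env_bdd)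
    (const hM2.var_fin.env_bdd 1)))
  exact get_set (reachIn (hM2.lift_fin hM2) ((hc.lift_fin hM).lift_fin hM2)
    ((hsnk.lift_fin hM).lift_fin hM2) hM2.var_fin) (hM.var_fin.lift_fin hM2)

theorem unitArc {a b d e : ∀ i, Fin (M i)} (ha : PolyComp m x (fun i => .atom (a i)))
    (hb : PolyComp m x (fun i => .atom (b i))) (hd : PolyComp m x (fun i => .atom (d i)))
    (he : PolyComp m x (fun i => .atom (e i))) :
    PolyComp m x (fun i => .atom (DetSampling.unitArc (a i) (b i) (d i) (e i))) :=
  (ite_atom (and (fin_eq hd ha) (fin_eq he hb)) (const ha.env_bdd 1) (zero ha.env_bdd)).congr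
    fun i => by unfold DetSampling.unitArc; congr

theorem closerNode {u : ∀ i, Fin (M i)} (hM : PolyComp m x (fun i => .atom (M i)))
    (hc : PolyComp m x (fun i => .matTab (c i))) (hsnk : PolyComp m x (fun i => .setTab (snk i)))
    (hu : PolyComp m x (fun i => .atom (u i))) :
    PolyComp m x (fun i => .atom (DetSampling.closerNode (c i) (snk i) (u i))) := by
  have hd := (sinkDist hM hc hsnk).lift_fin hM
  have hu' := hu.lift_fin hM
  refine pick hM (and (lt (zero hu'.env_bdd) (get_mat (hc.lift_fin hM) hu' hM.var_fin))
    (lt (get_fun hd hM.var_fin) (get_fun hd hu'))) hu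

theorem pushPath {u : ∀ i, Fin (M i)} (hM : PolyComp m x (fun i => .atom (M i)))
    (hc : PolyComp m x (fun i => .matTab (c i))) (hsnk : PolyComp m x (fun i => .setTab (snk i)))
    (hu : PolyComp m x (fun i => .atom (u i))) (hk : PolyComp m x (fun i => .atom (k i))) :
    PolyComp m x (fun i => .matTab (DetSampling.pushPath (c i) (snk i) (u i) (k i)).1) := by
  have hd := sinkDist hM hc hsnk
  refine PolyComp.fst (z := fun i => .atom (DetSampling.pushPath (c i) (snk i) (u i) (k i)).2) ?_
  refine rec' (s := fun i j => .pair (.matTab (DetSampling.pushPath (c i) (snk i) (u i) j).1)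
    (.atom (DetSampling.pushPath (c i) (snk i) (u i) j).2)) hk (hc.pair hu) ?_ ?_
  · refine (((hc.bdd.add hk.bdd_atom).max hM.bdd_atom).reindex _).mono fun q => ?_
    refine max_le_max (Val.top_matTab_le fun a b => (pushPath_le _ _ _ _ _ _).trans ?_)
      (DetSampling.pushPath _ _ _ _).2.2.le
    exact add_le_add (Val.le_top_matTab _ a b) q.2.2.le
  · intro v hl _ _ h
    have hM' := hl hM
    have hw := closerNode hM' (hl hc) (hl hsnk) h.snd
    have hM2 := hM'.lift_fin hM'
    have hrow := hM'.var_fin.lift_fin hM2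
    have hcol := hM2.var_fin
    have hcur := (h.snd.lift_fin hM').lift_fin hM2
    have hw2 := (hw.lift_fin hM').lift_fin hM2
    have hmat : PolyComp _ v fun q => .matTab fun a b =>
        (DetSampling.pushPath (c q.1) (snk q.1) (u q.1) q.2).1 a b +
          DetSampling.unitArc (DetSampling.closerNode (c q.1) (snk q.1)
            (DetSampling.pushPath (c q.1) (snk q.1) (u q.1) q.2).2)
            (DetSampling.pushPath (c q.1) (snk q.1) (u q.1) q.2).2 a b -
          DetSampling.unitArc (DetSampling.pushPath (c q.1) (snk q.1) (u q.1) q.2).2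
            (DetSampling.closerNode (c q.1) (snk q.1)
              (DetSampling.pushPath (c q.1) (snk q.1) (u q.1) q.2).2) a b :=
      tab hM' (funTab hM2 (sub (add (get_mat ((h.fst.lift_fin hM').lift_fin hM2) hrow hcol)
        (unitArc hw2 hcur hrow hcol)) (unitArc hcur hw2 hrow hcol)))
    refine (ite (eq (get_fun (hl hd) h.snd) (zero h.env_bdd)) h (hmat.pair hw)).congr fun q => ?_
    rw [pushPath_succ, pushStep]
    split <;> rfl

theorem augment {d : ∀ i, Fin (M i)} (hM : PolyComp m x (fun i => .atom (M i)))
    (hc : PolyComp m x (fun i => .matTab (c i))) (hsrc : PolyComp m x (fun i => .setTab (src i)))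
    (hsnk : PolyComp m x (fun i => .setTab (snk i))) (hd : PolyComp m x (fun i => .atom (d i))) :
    PolyComp m x (fun i => .matTab (DetSampling.augment (src i) (snk i) (d i) (c i))) := by
  have hr := canReach hM hc hsnk
  have hu : PolyComp m x (fun i => .atom
      (DetSampling.pick (fun u => src i u ∧ CanReach (c i) (snk i) u) (d i))) :=
    pick hM (and (get_set (hsrc.lift_fin hM) hM.var_fin) (get_set (hr.lift_fin hM) hM.var_fin)) hd
  refine (ite (and (get_set hsrc hu) (get_set hr hu)) (pushPath hM hc hsnk hu hM) hc).congr
    fun i => ?_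
  rw [DetSampling.augment]
  split <;> rfl

theorem residual {d : ∀ i, Fin (M i)} (hM : PolyComp m x (fun i => .atom (M i)))
    (hc : PolyComp m x (fun i => .matTab (c i))) (hsrc : PolyComp m x (fun i => .setTab (src i)))
    (hsnk : PolyComp m x (fun i => .setTab (snk i))) (hd : PolyComp m x (fun i => .atom (d i)))
    (hk : PolyComp m x (fun i => .atom (k i))) :
    PolyComp m x (fun i => .matTab (DetSampling.residual (src i) (snk i) (d i) (c i) (k i))) := by
  refine rec' (s := fun i j => .matTab (DetSampling.residual (src i) (snk i) (d i) (c i) j)) hk hc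
    ?_ ?_
  · refine ((hc.bdd.add (hk.bdd_atom.mul hM.bdd_atom)).reindex _).mono fun q =>
      Val.top_matTab_le fun a b => (residual_le _ _ _ _ _ _ _).trans ?_
    exact add_le_add (Val.le_top_matTab _ a b) (Nat.mul_le_mul_right _ q.2.2.le)
  · intro v hl _ _ h
    refine (augment (hl hM) h (hl hsrc) (hl hsnk) (hl hd)).congr fun q => ?_
    rw [residual_succ]

theorem furthestSide {d : ∀ i, Fin (M i)} (hM : PolyComp m x (fun i => .atom (M i)))
    (hc : PolyComp m x (fun i => .matTab (c i))) (hsrc : PolyComp m x (fun i => .setTab (src i)))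
    (hsnk : PolyComp m x (fun i => .setTab (snk i))) (hd : PolyComp m x (fun i => .atom (d i)))
    (hk : PolyComp m x (fun i => .atom (k i))) :
    PolyComp m x (fun i => .setTab
      (fun u => u ∈ DetSampling.furthestSide (src i) (snk i) (d i) (c i) (k i))) := by
  have h := canReach hM (residual hM hc hsrc hsnk hd hk) hsnk
  refine setTab hM ((not (get_set (h.lift_fin hM) hM.var_fin)).iff fun q => ?_)
  simp [DetSampling.furthestSide]

end Flow

end PolyComp

theorem sum_fin_lt {a q : ℕ} (h : q ≤ a) : (∑ j : Fin a, if j.val < q then 1 else 0) = q := by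
  rw [Fin.sum_univ_eq_sum_range (fun j => if j < q then 1 else 0) a, ← Finset.card_filter,
    show (Finset.range a).filter (· < q) = Finset.range q by ext; simp; omega, Finset.card_range]

/-- The quotient counts the positive multiples of b up to a, which makes division a bounded sum. -/
theorem div_eq_sum {a b : ℕ} (hb : 0 < b) :
    a / b = ∑ j : Fin a, if (j.val + 1) * b ≤ a then 1 else 0 := by
  rw [← sum_fin_lt (Nat.div_le_self a b)]
  refine Finset.sum_congr rfl fun j _ => if_congr ?_ rfl rfl
  rw [← Nat.le_div_iff_mul_le hb, Nat.succ_le_iff]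

theorem log_eq_sum (n : ℕ) :
    Nat.log 2 n = ∑ j : Fin n, if 0 < n / 2 ^ (j.val + 1) then 1 else 0 := by
  rw [← sum_fin_lt (Nat.log_le_self 2 n)]
  refine Finset.sum_congr rfl fun j _ => if_congr ?_ rfl rfl
  have hn : n ≠ 0 := by have := j.2; omega
  rw [Nat.div_pos_iff, ← Nat.le_log_iff_pow_le (by norm_num) hn, Nat.succ_le_iff]
  simp

namespace PolyComp

variable {ι : Type} {m : ι → ℕ} {x : ι → Val}

/-! ### Binary arithmetic -/

theorem div {a b : ι → ℕ} (ha : PolyComp m x (fun i => .atom (a i)))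
    (hb : PolyComp m x (fun i => .atom (b i))) (h : ∀ i, 0 < b i) :
    PolyComp m x (fun i => .atom (a i / b i)) := by
  refine (sum_fin (f := fun i j => if (j.val + 1) * b i ≤ a i then 1 else 0) ha ?_).congr fun i => by
    rw [div_eq_sum (h i)]
  exact (ite_atom (le (mul (succ ha.var_fin) (hb.lift_fin ha)) (ha.lift_fin ha))
    (const ha.var_fin.env_bdd 1) (zero ha.var_fin.env_bdd)).congr fun q => by congr

theorem mod {a b : ι → ℕ} (ha : PolyComp m x (fun i => .atom (a i)))
    (hb : PolyComp m x (fun i => .atom (b i))) (h : ∀ i, 0 < b i) :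
    PolyComp m x (fun i => .atom (a i % b i)) :=
  (sub ha (mul hb (div ha hb h))).congr fun i => by
    congr 1
    have := Nat.div_add_mod (a i) (b i)
    omega

theorem div_two_pow {a k : ι → ℕ} (ha : PolyComp m x (fun i => .atom (a i)))
    (hk : PolyComp m x (fun i => .atom (k i))) :
    PolyComp m x (fun i => .atom (a i / 2 ^ k i)) :=
  rec' (s := fun i j => .atom (a i / 2 ^ j)) hk (ha.congr fun i => by simp)
    ((ha.bdd_atom.reindex _).mono fun q => Nat.div_le_self _ _)
    fun _ _ _ h => (div h (const h.env_bdd 2) fun _ => by norm_num).congr fun q => by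
      rw [Nat.div_div_eq_div_mul, pow_succ]

theorem testBit {a k : ι → ℕ} (ha : PolyComp m x (fun i => .atom (a i)))
    (hk : PolyComp m x (fun i => .atom (k i))) :
    PolyComp m x (fun i => .ofProp ((a i).testBit (k i) = true)) :=
  (eq (mod (div_two_pow ha hk) (const ha.env_bdd 2) fun _ => by norm_num)
    (const ha.env_bdd 1)).iff fun i => by
      rw [Nat.testBit_eq_decide_div_mod_eq, decide_eq_true_eq]

theorem log_two {a : ι → ℕ} (ha : PolyComp m x (fun i => .atom (a i))) :
    PolyComp m x (fun i => .atom (Nat.log 2 (a i))) := by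
  refine (sum_fin (f := fun i j => if 0 < a i / 2 ^ (j.val + 1) then 1 else 0) ha ?_).congr
    fun i => by rw [log_eq_sum]
  exact (ite_atom (lt (zero ha.var_fin.env_bdd) (div_two_pow (ha.lift_fin ha) (succ ha.var_fin)))
    (const ha.var_fin.env_bdd 1) (zero ha.var_fin.env_bdd)).congr fun q => by congr

/-! ### Computability of the branching and of the separator test. -/

section Branching

variable {n p : ι → ℕ} {G : ∀ i, Digraph (Fin (n i))} {W T X A : ∀ i, Finset (Fin (n i))}

theorem divNat {u : ∀ i, Fin (n i * 2)} (hu : PolyComp m x (fun i => .atom (u i))) :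
    PolyComp m x (fun i => .atom (u i).divNat) :=
  (div hu (const hu.env_bdd 2) fun _ => by norm_num).congr fun i => by rw [Fin.coe_divNat]

theorem modNat {u : ∀ i, Fin (n i * 2)} (hu : PolyComp m x (fun i => .atom (u i))) :
    PolyComp m x (fun i => .atom (u i).modNat) :=
  (mod hu (const hu.env_bdd 2) fun _ => by norm_num).congr fun i => by rw [Fin.coe_modNat]

theorem modNat_eq {u : ∀ i, Fin (n i * 2)} (hu : PolyComp m x (fun i => .atom (u i))) (s : Fin 2) :
    PolyComp m x (fun i => .ofProp ((u i).modNat = s)) :=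
  fin_eq (n := fun _ => 2) (b := fun _ => s) (modNat hu) (const hu.env_bdd s)

theorem inNode {v : ∀ i, Fin (n i)} (hv : PolyComp m x (fun i => .atom (v i))) :
    PolyComp m x (fun i => .atom (DetSampling.inNode (v i))) :=
  (mul (const hv.env_bdd 2) hv).congr fun i => by simp [DetSampling.inNode]

theorem outNode {v : ∀ i, Fin (n i)} (hv : PolyComp m x (fun i => .atom (v i))) :
    PolyComp m x (fun i => .atom (DetSampling.outNode (v i))) :=
  (succ (mul (const hv.env_bdd 2) hv)).congr fun i => by
    simp [DetSampling.outNode, add_comm]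

theorem numNodes (hn : PolyComp m x (fun i => .atom (n i))) :
    PolyComp m x (fun i => .atom (n i * 2)) :=
  mul hn (const hn.env_bdd 2)

theorem isEntry (hn : PolyComp m x (fun i => .atom (n i)))
    (hA : PolyComp m x (fun i => .setTab (fun v => v ∈ A i))) :
    PolyComp m x (fun i => .setTab (IsEntry (A i))) := by
  have hN := numNodes hn
  refine setTab hN (and ((eq (modNat hN.var_fin) (zero hN.var_fin.env_bdd)).iff fun q => ?_)
    (get_set (hA.lift_fin hN) (divNat hN.var_fin)))
  rw [Fin.ext_iff]
  rfl

theorem netCap (hn : PolyComp m x (fun i => .atom (n i)))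
    (hG : PolyComp m x (fun i => .tab fun u => .setTab ((G i).Adj u)))
    (hW : PolyComp m x (fun i => .setTab (fun v => v ∈ W i)))
    (hX : PolyComp m x (fun i => .setTab (fun v => v ∈ X i)))
    (hA : PolyComp m x (fun i => .setTab (fun v => v ∈ A i)))
    (hp : PolyComp m x (fun i => .atom (p i))) :
    PolyComp m x (fun i => .matTab (DetSampling.netCap (G i) (W i) (p i) (X i) (A i))) := by
  have hN := numNodes hn
  have hN2 := hN.lift_fin hN
  have ha := hN.var_fin.lift_fin hN2
  have hb := hN2.var_fin
  have h0 := zero ha.env_bdd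
  have h1 := const ha.env_bdd 1
  have hp' := succ ((hp.lift_fin hN).lift_fin hN2)
  have lift : ∀ {B : ∀ i, Finset (Fin (n i))}, PolyComp m x (fun i => .setTab (fun v => v ∈ B i)) →
      PolyComp _ _ (fun q : (Σ q : (Σ i, Fin (n i * 2)), Fin (n q.1 * 2)) =>
        .ofProp (q.1.2.divNat ∈ B q.1.1)) :=
    fun hB => get_set ((hB.lift_fin hN).lift_fin hN2) (divNat ha)
  have hadj : PolyComp _ _ (fun q : (Σ q : (Σ i, Fin (n i * 2)), Fin (n q.1 * 2)) =>
      .ofProp ((G q.1.1).Adj q.1.2.divNat q.2.divNat)) :=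
    get_set (get (f := fun (q : (Σ q : (Σ i, Fin (n i * 2)), Fin (n q.1 * 2))) u =>
      .setTab ((G q.1.1).Adj u)) ((hG.lift_fin hN).lift_fin hN2) (divNat ha)) (divNat hb)
  refine tab hN (funTab hN2 ((ite_atom (modNat_eq ha 0) (ite_atom (and (modNat_eq hb 1)
    (fin_eq (divNat ha) (divNat hb))) (ite_atom (lift hX) h0 (ite_atom (or (lift hW) (lift hA))
    hp' h1)) h0) (ite_atom (and (modNat_eq hb 0) hadj) hp' h0)).congr fun q => ?_))
  unfold DetSampling.netCap vertexCap
  congr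

theorem isCrossing {v : ∀ i, Fin (n i)} (hn : PolyComp m x (fun i => .atom (n i)))
    (hG : PolyComp m x (fun i => .tab fun u => .setTab ((G i).Adj u)))
    (hW : PolyComp m x (fun i => .setTab (fun v => v ∈ W i)))
    (hT : PolyComp m x (fun i => .setTab (fun v => v ∈ T i)))
    (hp : PolyComp m x (fun i => .atom (p i)))
    (hv : PolyComp m x (fun i => .atom (v i)))
    (hX : PolyComp m x (fun i => .setTab (fun v => v ∈ X i)))
    (hA : PolyComp m x (fun i => .setTab (fun v => v ∈ A i))) :
    PolyComp m x (fun i => .setTab (IsCrossing (G i) (W i) (T i) (p i) (v i) (X i, A i))) := by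
  have hF := furthestSide (numNodes hn) (netCap hn hG hW hX hA hp) (isEntry hn hA) (isEntry hn hT)
    (inNode hv) (succ hp)
  exact setTab hn (and (get_set (hF.lift_fin hn) (inNode hn.var_fin))
    (and (not (get_set (hF.lift_fin hn) (outNode hn.var_fin)))
      (not (get_set (hX.lift_fin hn) hn.var_fin))))

theorem branchState {v : ∀ i, Fin (n i)} {b k : ι → ℕ} (hn : PolyComp m x (fun i => .atom (n i)))
    (hG : PolyComp m x (fun i => .tab fun u => .setTab ((G i).Adj u)))
    (hW : PolyComp m x (fun i => .setTab (fun v => v ∈ W i)))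
    (hT : PolyComp m x (fun i => .setTab (fun v => v ∈ T i)))
    (hp : PolyComp m x (fun i => .atom (p i)))
    (hv : PolyComp m x (fun i => .atom (v i)))
    (hb : PolyComp m x (fun i => .atom (b i)))
    (hk : PolyComp m x (fun i => .atom (k i))) :
    PolyComp m x (fun i => .setTab (fun u =>
      u ∈ (DetSampling.branchState (G i) (W i) (T i) (p i) (v i) (b i) (k i)).1)) := by
  refine PolyComp.fst (z := fun i => .setTab (fun u =>
      u ∈ (DetSampling.branchState (G i) (W i) (T i) (p i) (v i) (b i) (k i)).2)) ?_
  refine rec' (s := fun i j => .pair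
    (.setTab fun u => u ∈ (DetSampling.branchState (G i) (W i) (T i) (p i) (v i) (b i) j).1)
    (.setTab fun u => u ∈ (DetSampling.branchState (G i) (W i) (T i) (p i) (v i) (b i) j).2)) hk
    ?_ (PolyBdd.setTab.max PolyBdd.setTab) ?_
  · refine pair (setTab hn ?_) (setTab hn ?_)
    · exact (lt (zero hn.var_fin.env_bdd) (zero hn.var_fin.env_bdd)).iff fun q => by
        simp [DetSampling.branchState]
    · exact (fin_eq hn.var_fin (hv.lift_fin hn)).iff fun q => by
        simp [DetSampling.branchState]
  · intro w hl _ hj h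
    have hn' := hl hn
    have hc := isCrossing hn' (hl hG) (hl hW) (hl hT) (hl hp) (hl hv) h.fst h.snd
    have hbit := testBit (hl hb) hj
    have hc2 := get_set (p := fun q : (Σ q : (Σ i, Fin (k i)), Fin (n q.1)) =>
      IsCrossing (G q.1.1) (W q.1.1) (T q.1.1) (p q.1.1) (v q.1.1)
        (DetSampling.branchState (G q.1.1) (W q.1.1) (T q.1.1) (p q.1.1) (v q.1.1) (b q.1.1) q.1.2))
      (hc.lift_fin hn') hn'.var_fin
    have hy := pick (p := fun q : (Σ i, Fin (k i)) =>
      IsCrossing (G q.1) (W q.1) (T q.1) (p q.1) (v q.1)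
        (DetSampling.branchState (G q.1) (W q.1) (T q.1) (p q.1) (v q.1) (b q.1) q.2))
      hn' hc2 (hl hv)
    have hcy := get_set hc hy
    refine pair (setTab hn' ?_) (setTab hn' ?_)
    · refine (or (get_set (h.fst.lift_fin hn') hn'.var_fin) (and ((hcy.and hbit).lift_fin hn')
        (fin_eq hn'.var_fin (hy.lift_fin hn')))).iff fun q => ?_
      rw [DetSampling.branchState, branchStep]
      dsimp only
      split
      case isTrue h => rw [Finset.mem_insert]; simp only [h, true_and]; tauto
      case isFalse h => simp only [h, false_and, or_false]
    · refine (or (get_set (h.snd.lift_fin hn') hn'.var_fin) (and ((hcy.and hbit.not).lift_fin hn')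
        (fin_eq hn'.var_fin (hy.lift_fin hn')))).iff fun q => ?_
      rw [DetSampling.branchState, branchStep]
      dsimp only
      split
      case isTrue h => rw [Finset.mem_insert]; simp only [h, true_and]; tauto
      case isFalse h => simp only [h, false_and, or_false]

theorem isSeparator {v : ∀ i, Fin (n i)} (hn : PolyComp m x (fun i => .atom (n i)))
    (hG : PolyComp m x (fun i => .tab fun u => .setTab ((G i).Adj u)))
    (hW : PolyComp m x (fun i => .setTab (fun v => v ∈ W i)))
    (hT : PolyComp m x (fun i => .setTab (fun v => v ∈ T i)))
    (hv : PolyComp m x (fun i => .atom (v i)))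
    (hX : PolyComp m x (fun i => .setTab (fun v => v ∈ X i))) :
    PolyComp m x (fun i => .ofProp (IsSeparator (G i) (W i) {v i} (T i) (X i))) := by
  have mem : ∀ {B : ∀ i, Finset (Fin (n i))}, PolyComp m x (fun i => .setTab (fun v => v ∈ B i)) →
      PolyComp (ι := Σ i, Fin (n i)) (fun q => m q.1) (fun q => .pair (x q.1) (.atom q.2))
        (fun q => .ofProp (q.2 ∈ B q.1)) :=
    fun hB => get_set (hB.lift_fin hn) hn.var_fin
  have hn2 := hn.lift_fin hn
  have hc : PolyComp m x (fun i => .matTab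
      (open Classical in fun a b => if (G i).Adj a b ∧ b ∉ X i then 1 else 0)) := by
    refine tab hn (funTab hn2 ((ite_atom (and (get_set (get (f := fun
      (q : (Σ q : (Σ i, Fin (n i)), Fin (n q.1))) u => .setTab ((G q.1.1).Adj u))
      ((hG.lift_fin hn).lift_fin hn2) (hn.var_fin.lift_fin hn2)) hn2.var_fin)
      (not (get_set ((hX.lift_fin hn).lift_fin hn2) hn2.var_fin)))
      (const hn2.var_fin.env_bdd 1) (zero hn2.var_fin.env_bdd)).congr fun q => ?_))
    dsimp only
    congr
  exact (and (exists_fin hn (mem hT)) (and (not (get_set hT hv)) (and (not (get_set hX hv))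
    (and (forall_fin hn (imp (mem hX) (not (mem hT)))) (and (forall_fin hn (imp (mem hX)
      (not (mem hW)))) (not (get_set (canReach hn hc hT) hv))))))).iff fun i => isSeparator_iff

theorem card (hn : PolyComp m x (fun i => .atom (n i)))
    (hX : PolyComp m x (fun i => .setTab (fun v => v ∈ X i))) :
    PolyComp m x (fun i => .atom (X i).card) := by
  classical
  refine (sum_fin (f := fun i v => if v ∈ X i then 1 else 0) hn ?_).congr fun i => by simp
  exact (ite_atom (get_set (hX.lift_fin hn) hn.var_fin) (const hn.var_fin.env_bdd 1)
    (zero hn.var_fin.env_bdd)).congr fun q => by congr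

end Branching

/-! ### Computability of the colourings. -/

section Hashing

variable {n q : ι → ℕ} {w : ∀ i, Fin (n i) → Fin (n i) → ℕ}

theorem colorCost {h : ∀ i, Fin (n i) → Fin (q i + 1)} {v : ∀ i, Fin (n i)}
    {a : ∀ i, Fin (q i + 1)} (hn : PolyComp m x (fun i => .atom (n i)))
    (hw : PolyComp m x (fun i => .matTab (w i)))
    (hh : PolyComp m x (fun i => .funTab (fun u => (h i u : ℕ))))
    (hv : PolyComp m x (fun i => .atom (v i))) (ha : PolyComp m x (fun i => .atom (a i))) :
    PolyComp m x (fun i => .atom (DetSampling.colorCost (w i) (h i) (v i) (a i))) := by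
  refine sum_fin hn ?_
  refine (ite_atom (and (lt hn.var_fin (hv.lift_fin hn)) (eq (get_fun (hh.lift_fin hn) hn.var_fin)
    (ha.lift_fin hn))) (get_mat (hw.lift_fin hn) (hv.lift_fin hn) hn.var_fin)
    (zero hn.var_fin.env_bdd)).congr fun i => ?_
  simp only [Fin.lt_def, Fin.ext_iff]
  congr

theorem greedyColor {k : ι → ℕ} (hn : PolyComp m x (fun i => .atom (n i)))
    (hq : PolyComp m x (fun i => .atom (q i))) (hw : PolyComp m x (fun i => .matTab (w i)))
    (hk : PolyComp m x (fun i => .atom (k i))) :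
    PolyComp m x (fun i => .funTab
      (fun u => (DetSampling.greedyColor (q i) (w i) (k i) u : ℕ))) := by
  refine rec' (s := fun i j => .funTab fun u => (DetSampling.greedyColor (q i) (w i) j u : ℕ)) hk
    (funTab hn (zero hn.var_fin.env_bdd)) ?_ ?_
  · exact PolyBdd.funTab (((hq.bdd_atom.add (.const 1)).reindex _).mono fun r =>
      (DetSampling.greedyColor _ _ _ _).2.le)
  · intro u hl _ hj h
    have hn' := hl hn
    have hq1 := (succ (hl hq)).lift_fin hn'
    have hq2 := hq1.lift_fin hq1
    refine funTab hn' ?_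
    have hcost : ∀ {κ : Type} {e : κ → (Σ i, Fin (k i))} {m' : κ → ℕ} {y : κ → Val}
        {v : ∀ c, Fin (n (e c).1)} {a : ∀ c, Fin (q (e c).1 + 1)},
        (∀ {z : (Σ i, Fin (k i)) → Val}, PolyComp (fun q => m q.1) u z →
          PolyComp m' y (fun c => z (e c))) → PolyComp m' y (fun c => .atom (v c)) →
        PolyComp m' y (fun c => .atom (a c)) → PolyComp m' y (fun c => .atom
          (DetSampling.colorCost (w (e c).1) (DetSampling.greedyColor (q (e c).1) (w (e c).1)
            (e c).2) (v c) (a c))) :=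
      fun lift hv ha => colorCost (lift hn') (lift (hl hw)) (lift h) hv ha
    have hbest := pick (d := fun c : (Σ c : (Σ i, Fin (k i)), Fin (n c.1)) => 0)
      (p := fun (c : (Σ c : (Σ i, Fin (k i)), Fin (n c.1))) a => ∀ b,
        DetSampling.colorCost (w c.1.1) (DetSampling.greedyColor (q c.1.1) (w c.1.1) c.1.2) c.2 a ≤
        DetSampling.colorCost (w c.1.1) (DetSampling.greedyColor (q c.1.1) (w c.1.1) c.1.2) c.2 b)
      hq1 (forall_fin hq2 (le
        (hcost (fun hz => ((hz.lift_fin hn').lift_fin hq1).lift_fin hq2)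
          ((hn'.var_fin.lift_fin hq1).lift_fin hq2) (hq1.var_fin.lift_fin hq2))
        (hcost (fun hz => ((hz.lift_fin hn').lift_fin hq1).lift_fin hq2)
          ((hn'.var_fin.lift_fin hq1).lift_fin hq2) hq2.var_fin)))
      (zero hn'.var_fin.env_bdd)
    refine (ite_atom (eq hn'.var_fin (hj.lift_fin hn')) hbest
      (get_fun (h.lift_fin hn') hn'.var_fin)).congr fun c => ?_
    rw [greedyColor_succ]
    split <;> rfl

/-- Weights may double in every round, so no polynomial bound follows from the recursion itself. The
bound B is a hypothesis, supplied later by `pairWeight_le`. -/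
theorem pairWeight {k B : ι → ℕ} (hn : PolyComp m x (fun i => .atom (n i)))
    (hq : PolyComp m x (fun i => .atom (q i))) (hk : PolyComp m x (fun i => .atom (k i)))
    (hB : PolyBdd m B)
    (hle : ∀ i, ∀ l ≤ k i, ∀ a b, DetSampling.pairWeight (n i) (q i) l a b ≤ B i) :
    PolyComp m x (fun i => .matTab (DetSampling.pairWeight (n i) (q i) (k i))) := by
  have hn2 := hn.lift_fin hn
  refine rec' (s := fun i j => .matTab (DetSampling.pairWeight (n i) (q i) j)) hk
    (tab hn (funTab hn2 (const hn2.var_fin.env_bdd 1)))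
    ((hB.reindex _).mono fun c => Val.top_matTab_le (hle c.1 c.2 c.2.2.le)) ?_
  intro u hl _ _ h
  have hn' := hl hn
  have hn2' := hn'.lift_fin hn'
  have hg := greedyColor hn' (hl hq) h hn'
  have ha := hn'.var_fin.lift_fin hn2'
  have hb := hn2'.var_fin
  have hg2 := (hg.lift_fin hn').lift_fin hn2'
  have hw := get_mat ((h.lift_fin hn').lift_fin hn2') ha hb
  have hcol : ∀ {a : ∀ c : (Σ c : (Σ c : (Σ i, Fin (k i)), Fin (n c.1)), Fin (n c.1.1)),
      Fin (n c.1.1.1)}, PolyComp _ _ (fun c => .atom (a c)) →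
      PolyComp _ _ (fun c => .atom (DetSampling.hashColor (n c.1.1.1) (q c.1.1.1) c.1.1.2 (a c))) :=
    fun ha => get_fun (f := fun (c : (Σ c : (Σ c : (Σ i, Fin (k i)), Fin (n c.1)), Fin (n c.1.1))) u =>
      (DetSampling.hashColor (n c.1.1.1) (q c.1.1.1) c.1.1.2 u : ℕ)) hg2 ha
  refine tab hn' (funTab hn2' ((add hw (ite_atom (and (not (fin_eq ha hb))
    (fin_eq (hcol ha) (hcol hb))) hw (zero hw.env_bdd))).congr fun c => ?_))
  rw [pairWeight_succ]
  congr

theorem hashColor {k B : ι → ℕ} (hn : PolyComp m x (fun i => .atom (n i)))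
    (hq : PolyComp m x (fun i => .atom (q i))) (hk : PolyComp m x (fun i => .atom (k i)))
    (hB : PolyBdd m B)
    (hle : ∀ i, ∀ l ≤ k i, ∀ a b, DetSampling.pairWeight (n i) (q i) l a b ≤ B i) :
    PolyComp m x (fun i => .funTab (fun v => (DetSampling.hashColor (n i) (q i) (k i) v : ℕ))) :=
  greedyColor hn hq (pairWeight hn hq hk hB hle) hn

end Hashing

end PolyComp

/-! ### Size of the sample, and computability of the sampled sets. -/

theorem four_mul_numPairs_le (p : ℕ) : 4 * numPairs p ≤ 2 ^ (5 * (p + 1)) := by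
  have hp : p ≤ 2 ^ p := p.lt_two_pow_self.le
  have h1 : p * (p * (2 ^ (2 * p + 1) * p)) ≤ 2 ^ (5 * p + 1) :=
    calc _ ≤ 2 ^ p * (2 ^ p * (2 ^ (2 * p + 1) * 2 ^ p)) := by gcongr
      _ = _ := by rw [← pow_add, ← pow_add, ← pow_add]; congr 1; ring
  have h2 : 2 ^ (5 * (p + 1)) = 16 * 2 ^ (5 * p + 1) := by
    rw [show 5 * (p + 1) = 4 + (5 * p + 1) by ring, pow_add]; norm_num
  have h3 := Nat.two_pow_pos (5 * p + 1)
  unfold numPairs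
  omega

theorem sampleSize_le (n p : ℕ) :
    sampleSize n p ≤ 2 ^ 2 ^ (6 * (p + 1)) * (Nat.log 2 n + 1) := by
  have h0 := four_mul_numPairs_le p
  have hr : 0 < numPairs p := by unfold numPairs; omega
  have h1 : 6 * numPairs p ≤ 2 ^ (4 * numPairs p) := by
    calc 6 * numPairs p ≤ 2 ^ (3 * numPairs p) * 2 ^ numPairs p := by
          refine Nat.mul_le_mul ?_ (Nat.lt_two_pow_self).le
          exact le_trans (show 6 ≤ 2 ^ 3 by norm_num) (Nat.pow_le_pow_right (by omega) (by omega))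
      _ = _ := by rw [← pow_add]; congr 1; omega
  calc sampleSize n p ≤ 2 * numPairs p * (3 * (Nat.log 2 n + 1)) * 2 ^ (4 * numPairs p) := by
        unfold sampleSize numRounds numColorSets
        gcongr
        omega
    _ = 6 * numPairs p * 2 ^ (4 * numPairs p) * (Nat.log 2 n + 1) := by ring
    _ ≤ 2 ^ (4 * numPairs p) * 2 ^ (4 * numPairs p) * (Nat.log 2 n + 1) := by gcongr
    _ = 2 ^ (2 * (4 * numPairs p)) * (Nat.log 2 n + 1) := by rw [two_mul, pow_add]
    _ ≤ _ := by
        refine Nat.mul_le_mul_right _ (Nat.pow_le_pow_right (by omega) ?_)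
        calc 2 * (4 * numPairs p) ≤ 2 * 2 ^ (5 * (p + 1)) := by omega
          _ = 2 ^ (5 * (p + 1) + 1) := by rw [pow_succ, mul_comm]
          _ ≤ _ := Nat.pow_le_pow_right (by omega) (by omega)

namespace PolyComp

variable {ι : Type} {m : ι → ℕ} {x : ι → Val} {n p e : ι → ℕ} {G : ∀ i, Digraph (Fin (n i))}
  {W T : ∀ i, Finset (Fin (n i))}

theorem numPairs (hp : PolyComp m x (fun i => .atom (p i)))
    (hb : PolyBdd m (fun i => 2 ^ (2 * p i + 1))) :
    PolyComp m x (fun i => .atom (DetSampling.numPairs (p i))) :=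
  succ (mul hp (mul hp (mul (two_pow (succ (mul (const hp.env_bdd 2) hp)) hb) hp)))

theorem numColorSets (hp : PolyComp m x (fun i => .atom (p i)))
    (hb : PolyBdd m (fun i => 2 ^ (2 * p i + 1)))
    (hb' : PolyBdd m (fun i => DetSampling.numColorSets (p i))) :
    PolyComp m x (fun i => .atom (DetSampling.numColorSets (p i))) :=
  two_pow (mul (const hp.env_bdd 4) (numPairs hp hb)) hb'

theorem sampleSize (hn : PolyComp m x (fun i => .atom (n i)))
    (hp : PolyComp m x (fun i => .atom (p i)))
    (hb : PolyBdd m (fun i => 2 ^ (2 * p i + 1)))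
    (hb' : PolyBdd m (fun i => DetSampling.numColorSets (p i))) :
    PolyComp m x (fun i => .atom (DetSampling.sampleSize (n i) (p i))) :=
  mul (mul (mul (const hp.env_bdd 2) (numPairs hp hb)) (add (mul (const hp.env_bdd 2)
    (log_two hn)) (const hp.env_bdd 3))) (numColorSets hp hb hb')

theorem candidate {v : ∀ i, Fin (n i)} {b : ι → ℕ} (hn : PolyComp m x (fun i => .atom (n i)))
    (hG : PolyComp m x (fun i => .tab fun u => .setTab ((G i).Adj u)))
    (hW : PolyComp m x (fun i => .setTab (fun v => v ∈ W i)))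
    (hT : PolyComp m x (fun i => .setTab (fun v => v ∈ T i)))
    (hp : PolyComp m x (fun i => .atom (p i)))
    (hv : PolyComp m x (fun i => .atom (v i))) (hb : PolyComp m x (fun i => .atom (b i))) :
    PolyComp m x (fun i => .setTab (fun u =>
      u ∈ DetSampling.candidate (G i) (W i) (T i) (p i) (v i) (b i))) :=
  branchState hn hG hW hT hp hv hb (succ (mul (const hp.env_bdd 2) hp))

theorem selected (hn : PolyComp m x (fun i => .atom (n i)))
    (hp : PolyComp m x (fun i => .atom (p i))) (he : PolyComp m x (fun i => .atom (e i)))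
    (hb : PolyBdd m (fun i => 2 ^ (2 * p i + 1)))
    (hb' : PolyBdd m (fun i => DetSampling.numColorSets (p i)))
    (hlt : ∀ i, e i < DetSampling.sampleSize (n i) (p i)) :
    PolyComp m x (fun i => .setTab (fun v : Fin (n i) => Selected (n i) (p i) (e i) v)) := by
  have hC := numColorSets hp hb hb'
  have hpos : ∀ i, 0 < DetSampling.numColorSets (p i) := fun i => Nat.two_pow_pos _
  -- Here 2^(2 log n + 3) is at most 8(n + 1)², so the weights are polynomial in n.
  have hB : PolyBdd m (fun i => 2 ^ numRounds (n i) * (n i * n i)) := by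
    refine ((PolyBdd.const 8).mul ((hn.bdd_atom.add (.const 1)).mul
      (hn.bdd_atom.add (.const 1)))).mul (hn.bdd_atom.mul hn.bdd_atom) |>.mono fun i => ?_
    refine Nat.mul_le_mul_right _ ?_
    have h : 2 ^ Nat.log 2 (n i) ≤ n i + 1 := by
      rcases Nat.eq_zero_or_pos (n i) with h | h
      · simp [h]
      · exact (Nat.pow_log_le_self 2 h.ne').trans (Nat.le_succ _)
    calc 2 ^ numRounds (n i) = 8 * (2 ^ Nat.log 2 (n i) * 2 ^ Nat.log 2 (n i)) := by
          unfold numRounds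
          rw [pow_add, two_mul, pow_add, mul_comm]
          norm_num
      _ ≤ _ := Nat.mul_le_mul_left _ (Nat.mul_le_mul h h)
  -- The round number e / 2^(4r) is below 2rs because e is below the sample size; this is the
  -- condition 2l ≤ (q+1)s of `pairWeight_le` with q + 1 = 4r.
  have hh := hashColor hn (pred (mul (const hn.env_bdd 4) (numPairs hp hb))) (div he hC hpos) hB
    fun i l hl a b => pairWeight_le (by
      have h1 : e i / DetSampling.numColorSets (p i) <
          2 * DetSampling.numPairs (p i) * numRounds (n i) :=
        Nat.div_lt_of_lt_mul ((hlt i).trans_eq (mul_comm _ _))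
      have h2 : 0 < DetSampling.numPairs (p i) := by unfold DetSampling.numPairs; omega
      rw [show 4 * DetSampling.numPairs (p i) - 1 + 1 = 2 * (2 * DetSampling.numPairs (p i)) by omega,
        mul_assoc]
      omega) a b
  refine setTab hn (testBit ((mod he hC hpos).lift_fin hn) ?_)
  exact get_fun (f := fun (q : Σ i, Fin (n i)) v => (DetSampling.hashColor (n q.1)
    (4 * DetSampling.numPairs (p q.1) - 1) (e q.1 / DetSampling.numColorSets (p q.1)) v : ℕ))
    (hh.lift_fin hn) hn.var_fin

theorem sampleSet (hn : PolyComp m x (fun i => .atom (n i)))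
    (hG : PolyComp m x (fun i => .tab fun u => .setTab ((G i).Adj u)))
    (hW : PolyComp m x (fun i => .setTab (fun v => v ∈ W i)))
    (hT : PolyComp m x (fun i => .setTab (fun v => v ∈ T i)))
    (hp : PolyComp m x (fun i => .atom (p i))) (he : PolyComp m x (fun i => .atom (e i)))
    (hb : PolyBdd m (fun i => 2 ^ (2 * p i + 1)))
    (hb' : PolyBdd m (fun i => DetSampling.numColorSets (p i)))
    (hlt : ∀ i, e i < DetSampling.sampleSize (n i) (p i)) :
    PolyComp m x (fun i => .setTab (fun v =>
      v ∈ DetSampling.sampleSet (G i) (W i) (T i) (p i) (e i))) := by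
  have hsel := selected hn hp he hb hb' hlt
  have hnum := (two_pow (succ (mul (const hp.env_bdd 2) hp)) hb).lift_fin hn
  have l2 : ∀ {y : ι → Val}, PolyComp m x y → PolyComp _ _
      (fun q : (Σ q : (Σ i, Fin (n i)), Fin (2 ^ (2 * p q.1 + 1))) => y q.1.1) :=
    fun h => (h.lift_fin hn).lift_fin hnum
  have hv := hn.var_fin.lift_fin hnum
  have hc := candidate (l2 hn) (l2 hG) (l2 hW) (l2 hT) (l2 hp) hv hnum.var_fin
  have hn' := l2 hn
  have hbody := and (isSeparator hn' (l2 hG) (l2 hW) (l2 hT) hv hc) (and (le (card hn' hc) (l2 hp))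
    (forall_fin hn' (p := fun (q : (Σ q : (Σ i, Fin (n i)), Fin (2 ^ (2 * p q.1 + 1)))) u =>
      u ∈ DetSampling.candidate (G q.1.1) (W q.1.1) (T q.1.1) (p q.1.1) q.1.2 q.2 →
        Selected (n q.1.1) (p q.1.1) (e q.1.1) u)
      (imp (get_set (hc.lift_fin hn') hn'.var_fin)
        (get_set (p := fun (q : (Σ q : (Σ q : (Σ i, Fin (n i)), Fin (2 ^ (2 * p q.1 + 1))),
            Fin (n q.1.1))) u => Selected (n q.1.1.1) (p q.1.1.1) (e q.1.1.1) u)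
          ((l2 hsel).lift_fin hn') hn'.var_fin))))
  refine setTab hn ((exists_fin (p := fun (q : Σ i, Fin (n i)) (b : Fin (2 ^ (2 * p q.1 + 1))) =>
    IsSeparator (G q.1) (W q.1) {q.2} (T q.1)
      (DetSampling.candidate (G q.1) (W q.1) (T q.1) (p q.1) q.2 b) ∧
    (DetSampling.candidate (G q.1) (W q.1) (T q.1) (p q.1) q.2 b).card ≤ p q.1 ∧
    ∀ u, u ∈ DetSampling.candidate (G q.1) (W q.1) (T q.1) (p q.1) q.2 b →
      Selected (n q.1) (p q.1) (e q.1) u) hnum hbody).iff fun q => ?_)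
  simp [DetSampling.sampleSet]

end PolyComp

/-- The inputs of the algorithm. -/
structure Input where
  n : ℕ
  G : Digraph (Fin n)
  dec : DecidableRel G.Adj
  W : Finset (Fin n)
  T : Finset (Fin n)
  p : ℕ

namespace Input

/-- The input as a tree. -/
def encode (I : Input) : Val := haveI := I.dec; encodeInput I.G I.W I.T I.p

/-- The running time is polynomial in this number. -/
def magnitude (I : Input) : ℕ := 2 ^ 2 ^ (5 * (I.p + 1)) * (I.n + 2)

end Input

theorem Val.ofBool_decide (P : Prop) [Decidable P] : Val.ofBool (decide P) = Val.ofProp P := by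
  by_cases h : P <;> simp [Val.ofBool, Val.ofProp, h]

theorem encodeSet_eq {n : ℕ} (A : Finset (Fin n)) : encodeSet A = .setTab fun v => v ∈ A := by
  simp [encodeSet, Val.setTab, Val.tab, Val.ofBool_decide, List.ofFn_eq_map]

theorem encodeGraph_eq {n : ℕ} (G : Digraph (Fin n)) [DecidableRel G.Adj] :
    encodeGraph G = .tab fun u => .setTab (G.Adj u) := by
  simp [encodeGraph, Val.setTab, Val.tab, Val.ofBool_decide, List.ofFn_eq_map]

theorem encodeFamily_ofFn {n t : ℕ} (Z : Fin t → Finset (Fin n)) :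
    encodeFamily (List.ofFn Z) = .tab fun e => .setTab fun v => v ∈ Z e := by
  simp [encodeFamily, Val.tab, List.map_ofFn, Function.comp_def, encodeSet_eq]

theorem Val.top_setTab_le {n : ℕ} (p : Fin n → Prop) : (setTab p).top ≤ 1 :=
  top_tab_le fun j => by unfold Val.ofProp; split <;> simp

theorem polyBdd_encode : PolyBdd Input.magnitude (fun I => I.encode.top) := by
  refine ⟨1, fun I => ?_⟩
  have h0 : I.p < 2 ^ 2 ^ (5 * (I.p + 1)) :=
    lt_of_lt_of_le (b := 5 * (I.p + 1)) (by omega)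
      (Nat.lt_two_pow_self.le.trans Nat.lt_two_pow_self.le)
  have h1 : 1 ≤ 2 ^ 2 ^ (5 * (I.p + 1)) := Nat.one_le_two_pow
  have h2 : 2 ^ 2 ^ (5 * (I.p + 1)) ≤ I.magnitude := Nat.le_mul_of_pos_right _ (by omega)
  have h3 : I.n + 2 ≤ I.magnitude := Nat.le_mul_of_pos_left _ (by omega)
  rw [pow_one]
  let := I.dec
  refine Val.top_ofList fun a ha => ?_
  rw [encodeGraph_eq, encodeSet_eq, encodeSet_eq] at ha
  simp only [List.mem_cons, List.not_mem_nil, or_false] at ha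
  rcases ha with rfl | rfl | rfl | rfl | rfl
  · simp only [Val.top_atom]; omega
  · exact (Val.top_tab_le fun j => Val.top_setTab_le _).trans (by omega)
  · exact (Val.top_setTab_le _).trans (by omega)
  · exact (Val.top_setTab_le _).trans (by omega)
  · simp only [Val.top_atom]; omega

/-- The sampling algorithm runs in time polynomial in the magnitude of the input. -/
theorem polyComp_sample : PolyComp Input.magnitude Input.encode (fun I =>
    .tab fun e : Fin (sampleSize I.n I.p) => .setTab fun v => v ∈ sampleSet I.G I.W I.T I.p e) := by
  have hx := PolyComp.env polyBdd_encode
  have h0 : PolyComp Input.magnitude Input.encode (fun I => .pair (.atom I.n)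
      (.pair (.tab fun u => .setTab (I.G.Adj u)) (.pair (.setTab fun v => v ∈ I.W)
        (.pair (.setTab fun v => v ∈ I.T) (.pair (.atom I.p) (.atom 0)))))) :=
    hx.congr fun I => by
      let := I.dec
      rw [← encodeGraph_eq, ← encodeSet_eq, ← encodeSet_eq]
      rfl
  have hn := h0.fst
  have hp := h0.snd.snd.snd.snd.fst
  have hpow : ∀ {f : ℕ → ℕ}, (∀ p, f p ≤ 2 ^ (5 * (p + 1))) →
      PolyBdd Input.magnitude (fun I => 2 ^ f I.p) := fun hf =>
    PolyBdd.self.mono fun I => (Nat.pow_le_pow_right (by omega) (hf I.p)).trans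
      (Nat.le_mul_of_pos_right _ (by omega))
  have hb := hpow (f := fun p => 2 * p + 1) fun p =>
    le_trans (by omega) (Nat.lt_two_pow_self (n := 5 * (p + 1))).le
  have hb' : PolyBdd Input.magnitude (fun I => numColorSets I.p) := hpow four_mul_numPairs_le
  have hs := PolyComp.sampleSize hn hp hb hb'
  exact PolyComp.tab hs (PolyComp.sampleSet (hn.lift_fin hs) (h0.snd.fst.lift_fin hs)
    (h0.snd.snd.fst.lift_fin hs) (h0.snd.snd.snd.fst.lift_fin hs) (hp.lift_fin hs) hs.var_fin
    (hb.reindex _) (hb'.reindex _) fun q => q.2.2)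

/-- With D the doubly exponential factor, the magnitude plus 2 is at most D²(n + 1). In its c-th
power the factor 2c in the exponent of 2 is absorbed by 2c ≤ 2^(2c), so it only shifts the upper
exponent. -/
theorem magnitude_pow_le (I : Input) (c : ℕ) :
    (I.magnitude + 2) ^ c ≤ 2 ^ 2 ^ ((2 * c + 6) * (I.p + 1)) * (I.n + 1) ^ (2 * c + 6) := by
  set D := 2 ^ 2 ^ (5 * (I.p + 1)) with hD
  have hD4 : 4 ≤ D := by
    calc 4 = 2 ^ 2 := by norm_num
      _ ≤ D := Nat.pow_le_pow_right (by omega)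
        (le_trans (by omega) (Nat.lt_two_pow_self (n := 5 * (I.p + 1))).le)
  have h1 : I.magnitude + 2 ≤ D ^ 2 * (I.n + 1) :=
    calc I.magnitude + 2 ≤ D * (4 * (I.n + 1)) := by
          change D * (I.n + 2) + 2 ≤ _
          nlinarith
      _ ≤ D * (D * (I.n + 1)) := by gcongr
      _ = _ := by ring
  calc (I.magnitude + 2) ^ c ≤ (D ^ 2 * (I.n + 1)) ^ c := by gcongr
    _ = 2 ^ (2 ^ (5 * (I.p + 1)) * (2 * c)) * (I.n + 1) ^ c := by
        rw [mul_pow, ← pow_mul, hD, ← pow_mul]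
    _ ≤ _ := by
        refine Nat.mul_le_mul (Nat.pow_le_pow_right (by omega) ?_)
          (Nat.pow_le_pow_right (by omega) (by omega))
        calc 2 ^ (5 * (I.p + 1)) * (2 * c) ≤ 2 ^ (5 * (I.p + 1)) * 2 ^ (2 * c) := by
              gcongr
              exact Nat.lt_two_pow_self.le
          _ = 2 ^ (5 * (I.p + 1) + 2 * c) := by rw [pow_add]
          _ ≤ _ := Nat.pow_le_pow_right (by omega) (by nlinarith)

end DetSampling

theorem mainTheorem4 :
    ∃ (P : DetSampling.Prog) (c : ℕ),
      ∀ (n : ℕ) (G : Digraph (Fin n)) [DecidableRel G.Adj] (W T : Finset (Fin n)) (p : ℕ),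
        T ⊆ W →
        ∃ (Z : List (Finset (Fin n))) (k : ℕ),
          DetSampling.Runs P (DetSampling.encodeInput G W T p) (DetSampling.encodeFamily Z) k ∧
          k ≤ 2 ^ (2 ^ (c * (p + 1))) * (n + 1) ^ c ∧
          Z.length ≤ 2 ^ (2 ^ (c * (p + 1))) * (Nat.log 2 n + 1) ∧
          (∀ A ∈ Z, Disjoint A T) ∧
          ∀ S Y : Finset (Fin n),
            Disjoint S W → S.card ≤ p → DetSampling.IsThin G W T S →
            (∀ v ∈ Y, ∃ S', S' ⊆ S ∧ DetSampling.IsImportantSeparator G W {v} T S') →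
            ∃ A ∈ Z, Disjoint S A ∧ Y ⊆ A := by
  obtain ⟨-, -, P, t, ⟨c, hc⟩, hP⟩ := DetSampling.polyComp_sample
  -- The term 2c serves the running time, and 6 is the constant in `sampleSize_le`.
  refine ⟨P, 2 * c + 6, fun n G _ W T p hTW => ?_⟩
  obtain ⟨k, hk, hrun⟩ := hP ⟨n, G, inferInstance, W, T, p⟩
  refine ⟨List.ofFn fun e : Fin (DetSampling.sampleSize n p) => DetSampling.sampleSet G W T p e, k,
    ?_, ?_, ?_, ?_, ?_⟩
  · rw [DetSampling.encodeFamily_ofFn]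
    exact hrun
  · exact hk.trans ((hc _).trans (DetSampling.magnitude_pow_le _ c))
  · rw [List.length_ofFn]
    refine (DetSampling.sampleSize_le n p).trans (Nat.mul_le_mul_right _ ?_)
    exact Nat.pow_le_pow_right (by omega) (Nat.pow_le_pow_right (by omega)
      (Nat.mul_le_mul_right _ (by omega)))
  · intro A hA
    obtain ⟨e, rfl⟩ := (List.mem_ofFn' _ _).1 hA
    exact DetSampling.sampleSet_disjoint e
  · intro S Y hSW hp hthin hY
    obtain ⟨e, he, h⟩ := DetSampling.exists_sampleSet hTW hSW hp hthin hY
    exact ⟨_, (List.mem_ofFn' _ _).2 ⟨⟨e, he⟩, rfl⟩, h⟩
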